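/- A *word* over a finite alphabet $\Sigma$ is a function from a finite subset of $\mathbb Z$ to $\Sigma$. The *convolution* of words $w_1,\dots,w_h$ is the word on the union of their domains whose symbol at $k$ is $(w_1(k),\dots,w_h(k))$, with a padding symbol $\#$ in place of each undefined entry. A set of words is *regular* if it is recognised by a finite automaton that reads the symbols of a word in the order of their positions (blanks at undefined positions), the position $0$ being marked. A relation on words is *automatic* if the convolutions of its tuples form a regular set. It is *semiautomatic* if fixing all arguments but any one always leaves a regular set. A family $\{L_d : d\in D\}$ of sets of words is an *automatic family* if $D$ and $\{\mathrm{conv}(d,x) : d\in D,\ x\in L_d\}$ are regular. A *grid* is a regular set $A$ of words together with a map $\mathrm{val}:A\to\mathbb R$ whose image $G$ is a dense subring of $\mathbb R$, such that the relations $x+y=z$, $x=y$, $x<y$ (for the values of words in $A$) are automatic and, for each fixed $c\in A$, the relation $c\cdot x=y$ is automatic. An axis-parallel rectangle of the grid is a set $[x_1,x_2]\times[y_1,y_2]$ with $x_1<x_2$, $y_1<y_2$ and $x_1,x_2,y_1,y_2\in G$. A family $\{E_d : d\in D\}$ of axis-parallel rectangles of the grid (with $D$ a set of words over a finite alphabet)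 is called automatic if the family of the sets $\{\mathrm{conv}(v,w) : v,w\in A,\ (\mathrm{val}(v),\mathrm{val}(w))\in E_d\}$, $d\in D$, is an automatic family. For $d,d'\in D$ write $d\equiv d'$ if $E_d$ and $E_{d'}$ have the same area. 1. In every grid, the axis-parallel rectangles form an automatic family; that is, there is an automatic family $\{E_d : d\in D\}$ whose members are exactly all axis-parallel rectangles of the grid. 2. In no grid is $\equiv$ automatic: for every grid and every automatic family $\{E_d : d\in D\}$ of all its axis-parallel rectangles, the relation $\equiv$ on $D$ is not automatic. 3. Let $p$ be a prime power and $\mathbb D_p=\{n/p^m : n,m\in\mathbb Z\}$. An *interleaved numeral* is a nonempty string $a_0a_1a_{-1}a_2a_{-2}\dots$ of base-$p$ digits, placed at the positions $0,1,2,\dots$, optionally with a sign $-$ at position $-1$; its value is $\pm\sum_k a_kp^k$. The set of all interleaved numerals is regular and its set of values is $\mathbb D_p$. If $A$ is any regular set of interleaved numerals whose set of values is $\mathbb D_p$ (for instance all of them), then $A$ is a grid, and for every automatic family $\{E_d : d\in D\}$ of all its axis-parallel rectangles the relation $\equiv$ on $D$ is semiautomatic. -/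

import Mathlib

open Set MeasureTheory

noncomputable section

/-- A word over `α`: a function from a finite set of integers to `α`. The value `none` says that
the word is not defined at that position. -/
@[ext]
structure ZWord (α : Type) where
  toFun : ℤ → Option α
  finite_dom : {k | toFun k ≠ none}.Finite

namespace ZWord

variable {α β : Type}

instance : CoeFun (ZWord α) (fun _ => ℤ → Option α) := ⟨ZWord.toFun⟩

/-- The sequence of symbols that an automaton reads on the positions `-m, …, n`; a position outside
the domain is read as a blank (`none`), and the flag marks the position `0`. -/
def window (w : ZWord α) (m n : ℕ) : List (Option α × Bool) :=
  (List.range (m + n + 1)).map fun i => (w ((i : ℤ) - (m : ℤ)), decide (i = m))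

open Classical in
/-- The convolution of two words: it is defined where at least one of them is, and the padding
symbol `#` (here `none`) replaces the value of the other one if it is undefined. -/
def conv (v : ZWord α) (w : ZWord β) : ZWord (Option α × Option β) where
  toFun k := if v k = none ∧ w k = none then none else some (v k, w k)
  finite_dom := by
    refine (v.finite_dom.union w.finite_dom).subset fun k hk => ?_
    by_contra h
    simp only [mem_union, mem_ofPred_eq, not_or, not_not] at h
    exact hk (if_pos h)

open Classical in
/-- The convolution of `h` words. -/
def convTuple {h : ℕ} (x : Fin h → ZWord α) : ZWord (Fin h → Option α) where
  toFun k := if ∀ i, x i k = none then none else some fun i => x i k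
  finite_dom := by
    refine (Set.finite_iUnion fun i => (x i).finite_dom).subset fun k hk => ?_
    by_contra hn
    simp only [mem_iUnion, mem_ofPred_eq, not_exists, not_not] at hn
    exact hk (if_pos hn)

end ZWord

/-- A set of words is regular if some finite automaton decides membership when it reads a word
along any interval `-m, …, n` that contains its domain. -/
def IsRegularSet {α : Type} (L : Set (ZWord α)) : Prop :=
  ∃ K : Language (Option α × Bool), K.IsRegular ∧
    ∀ (w : ZWord α) (m n : ℕ), (∀ k : ℤ, w k ≠ none → -(m : ℤ) ≤ k ∧ k ≤ (n : ℤ)) →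
      (w ∈ L ↔ w.window m n ∈ K)

/-- An `h`-ary relation is automatic if the convolutions of its tuples form a regular set. -/
def IsAutomaticRel {α : Type} {h : ℕ} (R : Set (Fin h → ZWord α)) : Prop :=
  IsRegularSet (ZWord.convTuple '' R)

/-- An `h`-ary relation is semiautomatic if fixing all arguments but one always leaves a regular
set of values of the remaining argument. -/
def IsSemiautomaticRel {α : Type} {h : ℕ} (R : Set (Fin h → ZWord α)) : Prop :=
  ∀ (i : Fin h) (x : Fin h → ZWord α), IsRegularSet {w | Function.update x i w ∈ R}

/-- `{L d : d ∈ D}` is an automatic family. -/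
structure IsAutomaticFamily {Γ Δ : Type} (D : Set (ZWord Γ)) (L : ZWord Γ → Set (ZWord Δ)) :
    Prop where
  index : IsRegularSet D
  members : IsRegularSet {u | ∃ d ∈ D, ∃ x ∈ L d, u = ZWord.conv d x}

/-- `(A, +, =, <; ·)` is a (semiautomatic) grid, where the word `w ∈ A` represents the real number
`val w`. Several words may represent the same number; addition and multiplication are functions up
to equality of values. -/
structure IsGrid {α : Type} (A : Set (ZWord α)) (val : ZWord α → ℝ) : Prop where
  domain : IsRegularSet A
  dense_subring : ∃ S : Subring ℝ, val '' A = (S : Set ℝ) ∧ Dense (S : Set ℝ)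
  add : IsAutomaticRel {x : Fin 3 → ZWord α |
    (∀ i, x i ∈ A) ∧ val (x 0) + val (x 1) = val (x 2)}
  eq : IsAutomaticRel {x : Fin 2 → ZWord α | (∀ i, x i ∈ A) ∧ val (x 0) = val (x 1)}
  lt : IsAutomaticRel {x : Fin 2 → ZWord α | (∀ i, x i ∈ A) ∧ val (x 0) < val (x 1)}
  /-- Multiplication by each fixed element is automatic (one side suffices, as `ℝ` is
  commutative). -/
  mul : ∀ c ∈ A, IsAutomaticRel {x : Fin 2 → ZWord α |
    (∀ i, x i ∈ A) ∧ val c * val (x 0) = val (x 1)}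

/-- The (closed, nondegenerate) axis-parallel rectangles whose corner points are in `S × S`. -/
def axisRectangles (S : Set ℝ) : Set (Set (ℝ × ℝ)) :=
  {R | ∃ x₁ ∈ S, ∃ x₂ ∈ S, ∃ y₁ ∈ S, ∃ y₂ ∈ S, x₁ < x₂ ∧ y₁ < y₂ ∧
    R = Icc x₁ x₂ ×ˢ Icc y₁ y₂}

/-- The words (convolutions of two words of `A`) that represent grid points in the planar set
`R`. -/
def gridPoints {α : Type} (A : Set (ZWord α)) (val : ZWord α → ℝ) (R : Set (ℝ × ℝ)) :
    Set (ZWord (Fin 2 → Option α)) :=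
  {u | ∃ v ∈ A, ∃ w ∈ A, (val v, val w) ∈ R ∧ u = ZWord.convTuple ![v, w]}

/-- `{E d : d ∈ D}` consists of all axis-parallel rectangles of the grid and, as a family of sets of
grid points, is an automatic family. -/
structure IsAutomaticRectangleFamily {α Γ : Type} (A : Set (ZWord α)) (val : ZWord α → ℝ)
    (D : Set (ZWord Γ)) (E : ZWord Γ → Set (ℝ × ℝ)) : Prop where
  all_rectangles : E '' D = axisRectangles (val '' A)
  automatic : IsAutomaticFamily D fun d => gridPoints A val (E d)

/-- The relation `d ≡ d'` on `D`: the sets `E d` and `E d'` have the same area. -/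
def sameArea {Γ : Type} (D : Set (ZWord Γ)) (E : ZWord Γ → Set (ℝ × ℝ)) :
    Set (Fin 2 → ZWord Γ) :=
  {d | (∀ i, d i ∈ D) ∧ volume (E (d 0)) = volume (E (d 1))}

/-- `𝔻_b = {n / b ^ m : n, m ∈ ℤ}`. -/
def adicRationals (b : ℕ) : Set ℝ :=
  {x | ∃ n m : ℤ, x = (n : ℝ) / (b : ℝ) ^ m}

/-- The symbols of base-`b` numerals: a digit, or the sign `-` (which is `Sum.inr ()`). -/
abbrev SignedDigit (b : ℕ) : Type := Fin b ⊕ Unit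

/-- The interleaved numerals `a₀ a₁ a₋₁ a₂ a₋₂ …`: a nonempty string of digits that starts at
position `0`, possibly with the sign `-` in front of it, at position `-1`. -/
def interleavedWords (b : ℕ) : Set (ZWord (SignedDigit b)) :=
  {w | (w (-1) = none ∨ w (-1) = some (Sum.inr ())) ∧
    (∀ k : ℤ, k < -1 → w k = none) ∧
    ∃ N : ℕ, ∀ k : ℕ, (k ≤ N → ∃ a : Fin b, w (k : ℤ) = some (Sum.inl a)) ∧
      (N < k → w (k : ℤ) = none)}

/-- The exponent that belongs to position `k` of an interleaved numeral: `0, 1, -1, 2, -2, …`. -/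
def interleavedExponent (k : ℕ) : ℤ :=
  if k % 2 = 0 then -((k / 2 : ℕ) : ℤ) else ((k / 2 + 1 : ℕ) : ℤ)

/-- The numerical value of a digit; everything else counts as `0`. -/
def digitValue {b : ℕ} : Option (SignedDigit b) → ℝ
  | some (Sum.inl a) => ((a : ℕ) : ℝ)
  | _ => 0

open Classical in
/-- The number that an interleaved numeral represents. -/
def interleavedValue (b : ℕ) (w : ZWord (SignedDigit b)) : ℝ :=
  (if w (-1) = some (Sum.inr ()) then -1 else 1) *
    ∑ᶠ k : ℕ, digitValue (w (k : ℤ)) * (b : ℝ) ^ interleavedExponent k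

end

/-! Regular properties of words are closed under Boolean operations, letterwise substitution and
quantification over words. So whatever is first-order definable from automatic relations is regular.

Part 1. A rectangle is indexed by the convolution of its four corner words; lying in it is a
conjunction of inequalities.

Part 2. In any automatic family, the relation between an index and the corner words is regular
(`IsGrid.regularPred_isRectangle`), since a rectangle with grid corners is determined by its grid
points. If equality of areas were automatic, so would be multiplication of positive elements: `x * y
= z` says that `[0,x] × [0,y]` and `[0,1] × [0,z]` have the same area. By pumping
(`RegularPred.exists_supportedIn`), an operation with regular graph enlarges supports by a bounded
amount only. Repeated squaring then puts all natural numbers below `2 ^ 2 ^ n` among the values of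
words of radius `O(n)`, of which there are only `2 ^ O(n)`, a contradiction.

Part 3. Adjacent exponents of an interleaved numeral stand at most two positions apart, so a fixed
integer linear equation is checked by guessing bounded carries and testing them locally
(`regularPred_linear`). This yields addition, equality, order and multiplication by constants. For
areas, fix the area `r` and write one side as `c * b ^ j` with `c` not divisible by the base `b`.
Because `b` is a prime power, only finitely many `c` are possible (`exists_factorization`); the
other side is `r / c * b ^ (-j)`. The exponents `j` and `-j` occupy neighbouring positions (or both
position `0`), so the pair `b ^ j`, `b ^ (-j)` is recognisable, and the area class is a finite union
of regular sets. -/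

noncomputable section

open ZWord

variable {α β X Γ : Type}

/-! ### Closure properties of regular languages, and pumping down -/

namespace Language

/-- The subset construction in Myhill–Nerode form: finitely many quotients of `K` have finitely many
subsets, and each quotient of `L` is computed from one of them. -/
theorem IsRegular.of_leftQuotient_eq {K : Language α} (hK : K.IsRegular) {L : Language β}
    (Φ : Set (Language α) → Language β)
    (h : ∀ x, ∃ S ⊆ range K.leftQuotient, L.leftQuotient x = Φ S) : L.IsRegular := by
  rw [isRegular_iff_finite_range_leftQuotient] at hK ⊢
  refine (hK.finite_subsets.image Φ).subset ?_
  rintro _ ⟨x, rfl⟩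
  obtain ⟨S, hS, hx⟩ := h x
  exact ⟨S, hS, hx.symm⟩

/-- Nondeterministic guessing of the preimage: a quotient of the image by `x` is governed by the
quotients of `K` by all preimages of `x`. -/
theorem IsRegular.image_map {K : Language α} (hK : K.IsRegular) (g : α → β) :
    IsRegular (T := β) {x | ∃ y ∈ K, y.map g = x} := by
  refine hK.of_leftQuotient_eq (fun S => {z | ∃ T ∈ S, ∃ y ∈ T, y.map g = z}) fun x => ?_
  refine ⟨{T | ∃ y, y.map g = x ∧ T = K.leftQuotient y}, ?_, ?_⟩
  · rintro _ ⟨y, -, rfl⟩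
    exact ⟨y, rfl⟩
  · ext z
    constructor
    · rintro ⟨y, hy, hxz⟩
      obtain ⟨y₁, y₂, rfl, h₁, h₂⟩ := List.map_eq_append_iff.1 hxz
      exact ⟨_, ⟨y₁, h₁, rfl⟩, y₂, hy, h₂⟩
    · rintro ⟨_, ⟨y₁, rfl, rfl⟩, y₂, hy, rfl⟩
      exact ⟨y₁ ++ y₂, hy, by simp⟩

theorem IsRegular.preimage_map {K : Language β} (hK : K.IsRegular) (g : α → β) :
    IsRegular (T := α) {x | x.map g ∈ K} := by
  obtain ⟨σ, hσ, M, rfl⟩ := hK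
  exact ⟨σ, hσ, M.comap g, by rw [DFA.accepts_comap]; rfl⟩

/-- The words of `K` with some padding symbols removed at both ends form a regular language. -/
theorem IsRegular.strip {K : Language α} (hK : K.IsRegular) (c : α) :
    IsRegular (T := α) {x | ∃ a b, List.replicate a c ++ x ++ List.replicate b c ∈ K} := by
  refine hK.of_leftQuotient_eq
    (fun S => {z | ∃ T ∈ S, ∃ b, z ++ List.replicate b c ∈ T}) fun x => ?_
  refine ⟨{T | ∃ a, T = K.leftQuotient (List.replicate a c ++ x)}, ?_, ?_⟩
  · rintro _ ⟨a, rfl⟩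
    exact ⟨_, rfl⟩
  · ext z
    constructor
    · rintro ⟨a, b, h⟩
      refine ⟨_, ⟨a, rfl⟩, b, ?_⟩
      change _ ++ _ ∈ K
      simpa using h
    · rintro ⟨_, ⟨a, rfl⟩, b, h⟩
      refine ⟨a, b, ?_⟩
      change _ ++ _ ∈ K at h
      simpa using h

end Language

/-- Loops of the run are cut out until none is forced. That the result is a sublist matters later:
cutting a stretch of blanks leaves blanks. -/
theorem DFA.exists_shorter {α σ : Type} [Fintype σ] (M : DFA α σ) (s : σ) (x : List α) :
    ∃ y : List α, y.Sublist x ∧ y.length ≤ Fintype.card σ ∧ M.evalFrom s y = M.evalFrom s x := by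
  induction hn : x.length using Nat.strong_induction_on generalizing x with
  | _ n ih =>
    by_cases hx : Fintype.card σ ≤ x.length
    · obtain ⟨q, a, b, c, rfl, -, hb, h₁, h₂, h₃⟩ := M.evalFrom_split (s := s) hx rfl
      have hlt : (a ++ c).length < n := by
        have := List.length_pos_iff.2 hb
        simp only [List.length_append] at hn ⊢
        omega
      obtain ⟨y, hy, hyl, hye⟩ := ih _ hlt (a ++ c) rfl
      refine ⟨y, hy.trans ?_, hyl, ?_⟩
      · simp
      · rw [hye, DFA.evalFrom_of_append, h₁, h₃]
    · exact ⟨x, List.Sublist.refl x, by omega, rfl⟩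

/-! ### Words, windows and padding -/

namespace ZWord

/-- The domain of `w` is contained in `[-m, n]`. -/
def SupportedIn (w : ZWord α) (m n : ℕ) : Prop :=
  ∀ k : ℤ, w k ≠ none → -(m : ℤ) ≤ k ∧ k ≤ (n : ℤ)

theorem SupportedIn.mono {w : ZWord α} {m n m' n' : ℕ} (h : w.SupportedIn m n) (hm : m ≤ m')
    (hn : n ≤ n') : w.SupportedIn m' n' := fun k hk => by
  have := h k hk
  omega

theorem exists_supportedIn (w : ZWord α) : ∃ m, w.SupportedIn m m := by
  obtain ⟨a, ha⟩ := w.finite_dom.bddBelow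
  obtain ⟨b, hb⟩ := w.finite_dom.bddAbove
  refine ⟨a.natAbs + b.natAbs, fun k hk => ?_⟩
  have h₁ := ha hk
  have h₂ := hb hk
  omega

/-- In `window` the list is coerced to integers through the list monad; this form has a natural
index. -/
theorem window_eq (w : ZWord α) (m n : ℕ) :
    w.window m n = (List.range (m + n + 1)).map fun i : ℕ => (w ((i : ℤ) - m), decide (i = m)) := by
  have h : ∀ l : List ℕ, (do let a ← l; pure (a : ℤ)) = l.map fun i : ℕ => (i : ℤ) := fun l => by
    induction l with
    | nil => rfl
    | cons a l ih => simpa [List.flatMap_cons] using ih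
  rw [window, h, List.map_map]
  simp [Function.comp_def]

@[simp] theorem length_window (w : ZWord α) (m n : ℕ) : (w.window m n).length = m + n + 1 := by
  simp [window_eq]

theorem getElem?_window (w : ZWord α) (m n i : ℕ) (hi : i < m + n + 1) :
    (w.window m n)[i]? = some (w ((i : ℤ) - m), decide (i = m)) := by
  simp [window_eq, hi]

theorem window_add {w : ZWord α} {m n : ℕ} (h : w.SupportedIn m n) (a b : ℕ) :
    w.window (m + a) (n + b) =
      List.replicate a (none, false) ++ w.window m n ++ List.replicate b (none, false) := by
  apply List.ext_getElem?
  intro i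
  by_cases hi : i < m + a + (n + b) + 1
  · rw [getElem?_window _ _ _ _ hi]
    by_cases h₁ : i < a
    · rw [List.append_assoc, List.getElem?_append_left (by simpa using h₁),
        List.getElem?_replicate_of_lt h₁]
      have : w ((i : ℤ) - (m + a : ℕ)) = none := by
        by_contra hne
        have := h _ hne
        omega
      rw [this]
      simp only [Option.some.injEq, Prod.mk.injEq, decide_eq_false_iff_not, true_and]
      omega
    · by_cases h₂ : i < a + (m + n + 1)
      · rw [List.getElem?_append_left (by simpa using h₂),
          List.getElem?_append_right (by simpa using h₁), getElem?_window _ _ _ _ (by simp; omega)]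
        simp only [List.length_replicate, Option.some.injEq, Prod.mk.injEq, decide_eq_decide]
        refine ⟨?_, by omega⟩
        congr 1
        omega
      · rw [List.getElem?_append_right (by simp; omega), List.getElem?_replicate_of_lt (by simp; omega)]
        have : w ((i : ℤ) - (m + a : ℕ)) = none := by
          by_contra hne
          have := h _ hne
          omega
        rw [this]
        simp only [Option.some.injEq, Prod.mk.injEq, decide_eq_false_iff_not, true_and]
        omega
  · rw [List.getElem?_eq_none (by simp; omega), List.getElem?_eq_none (by simp; omega)]

/-- The word that is read off from the list `l` if `l` starts at the position `-m`. -/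
def ofList (l : List (Option α × Bool)) (m : ℕ) : ZWord α where
  toFun k := if 0 ≤ k + m then (l[(k + m).toNat]?).bind Prod.fst else none
  finite_dom := by
    refine (Set.finite_Icc (-(m : ℤ)) l.length).subset fun k hk => ?_
    simp only [mem_ofPred_eq, ne_eq] at hk
    split_ifs at hk with h
    · have : (k + m).toNat < l.length := by
        by_contra hlt
        rw [List.getElem?_eq_none (by omega)] at hk
        exact hk rfl
      exact ⟨by omega, by omega⟩
    · exact absurd rfl hk

theorem ofList_supportedIn (l : List (Option α × Bool)) (m n : ℕ) (hl : l.length ≤ m + n + 1) :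
    (ofList l m).SupportedIn m n := by
  intro k hk
  simp only [ofList, ne_eq] at hk
  split_ifs at hk with h
  · have : (k + m).toNat < l.length := by
      by_contra hlt
      rw [List.getElem?_eq_none (by omega)] at hk
      exact hk rfl
    omega
  · exact absurd rfl hk

/-- A list is a window as soon as its flags mark exactly the entry `m`. -/
theorem window_ofList (l : List (Option α × Bool)) (m n : ℕ)
    (hl : l.map Prod.snd = (List.range (m + n + 1)).map fun i => decide (i = m)) :
    (ofList l m).window m n = l := by
  have hlen : l.length = m + n + 1 := by simpa using congrArg List.length hl
  apply List.ext_getElem?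
  intro i
  by_cases hi : i < m + n + 1
  · have h₁ : (ofList l m) ((i : ℤ) - m) = l[i].1 := by
      simp only [ofList, sub_add_cancel, Int.toNat_natCast]
      simp [hlen, hi]
    have h₂ : l[i].2 = decide (i = m) := by
      have := congrArg (fun t => t[i]?) hl
      simpa [hlen, hi] using this
    rw [getElem?_window _ _ _ _ hi, h₁, ← h₂, List.getElem?_eq_getElem]
  · rw [List.getElem?_eq_none (by simp; omega), List.getElem?_eq_none (by omega)]

theorem map_snd_window (w : ZWord α) (m n : ℕ) :
    (w.window m n).map Prod.snd = (List.range (m + n + 1)).map fun i => decide (i = m) := by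
  simp [window_eq, Function.comp_def]

theorem eq_of_window_eq {v w : ZWord α} {m n : ℕ} (hv : v.SupportedIn m n)
    (hw : w.SupportedIn m n) (h : v.window m n = w.window m n) : v = w := by
  ext1
  funext k
  by_cases hk : -(m : ℤ) ≤ k ∧ k ≤ n
  · have := congrArg (fun t => t[(k + m).toNat]?) h
    rw [getElem?_window _ _ _ _ (by omega), getElem?_window _ _ _ _ (by omega)] at this
    simp only [Option.some.injEq, Prod.mk.injEq, and_true] at this
    rwa [show (((k + m).toNat : ℕ) : ℤ) - m = k by omega] at this
  · rw [show v k = none from by_contra fun h => hk (hv k h),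
      show w k = none from by_contra fun h => hk (hw k h)]

/-- The letter-to-letter image of a word, where some letters may be deleted. -/
def filterMap (f : X → Option α) (w : ZWord X) : ZWord α where
  toFun k := (w k).bind f
  finite_dom := w.finite_dom.subset fun k hk => by
    simp only [mem_ofPred_eq] at hk ⊢
    intro h
    simp [h] at hk

@[simp] theorem filterMap_apply (f : X → Option α) (w : ZWord X) (k : ℤ) :
    w.filterMap f k = (w k).bind f := rfl

theorem SupportedIn.filterMap {w : ZWord X} {m n : ℕ} (h : w.SupportedIn m n) (f : X → Option α) :
    (w.filterMap f).SupportedIn m n := fun k hk => h k fun h0 => by simp [h0] at hk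

theorem window_filterMap (f : X → Option α) (w : ZWord X) (m n : ℕ) :
    (w.filterMap f).window m n = (w.window m n).map (Prod.map (fun o : Option X => o.bind f) id) := by
  simp [window_eq, Function.comp_def]

end ZWord

/-! ### Regular predicates and their closure properties -/

/-- A property of words that is decided by a finite automaton. -/
def RegularPred (P : ZWord X → Prop) : Prop := IsRegularSet {w | P w}

theorem IsRegularSet.regularPred {L : Set (ZWord X)} (h : IsRegularSet L) :
    RegularPred fun w => w ∈ L := h

namespace RegularPred

variable {P Q : ZWord X → Prop}

theorem congr (hP : RegularPred P) (h : ∀ w, Q w ↔ P w) : RegularPred Q := by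
  have : Q = P := funext fun w => propext (h w)
  rwa [this]

theorem not (hP : RegularPred P) : RegularPred fun w => ¬ P w := by
  obtain ⟨K, hK, h⟩ := hP
  exact ⟨Kᶜ, hK.compl, fun w m n hw => not_congr (h w m n hw)⟩

theorem and (hP : RegularPred P) (hQ : RegularPred Q) : RegularPred fun w => P w ∧ Q w := by
  obtain ⟨K, hK, h⟩ := hP
  obtain ⟨K', hK', h'⟩ := hQ
  exact ⟨K ⊓ K', hK.inf hK', fun w m n hw => and_congr (h w m n hw) (h' w m n hw)⟩

theorem or (hP : RegularPred P) (hQ : RegularPred Q) : RegularPred fun w => P w ∨ Q w :=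
  (hP.not.and hQ.not).not.congr fun w => by tauto

theorem imp (hP : RegularPred P) (hQ : RegularPred Q) : RegularPred fun w => P w → Q w :=
  (hP.not.or hQ).congr fun w => by tauto

theorem iff (hP : RegularPred P) (hQ : RegularPred Q) : RegularPred fun w => (P w ↔ Q w) :=
  ((hP.imp hQ).and (hQ.imp hP)).congr fun w => by tauto

theorem filterMap {P : ZWord α → Prop} (hP : RegularPred P) (f : X → Option α) :
    RegularPred fun w => P (w.filterMap f) := by
  obtain ⟨K, hK, h⟩ := hP
  refine ⟨_, hK.preimage_map (Prod.map (fun o : Option X => o.bind f) id), fun w m n hw => ?_⟩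
  refine (h (w.filterMap f) m n (SupportedIn.filterMap hw f)).trans ?_
  rw [window_filterMap]
  rfl

/-- Projection. The witness may extend beyond the window of `v`, where it is seen as blanks; hence
padding is stripped from the image language. -/
theorem exists_filterMap_eq (hP : RegularPred P) (f : X → Option β) :
    RegularPred fun v => ∃ w, w.filterMap f = v ∧ P w := by
  obtain ⟨K, hK, h⟩ := hP
  refine ⟨_, (hK.image_map (Prod.map (fun o : Option X => o.bind f) id)).strip (none, false),
    fun v m n hv => ?_⟩
  change SupportedIn v m n at hv
  constructor
  · rintro ⟨w, rfl, hw⟩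
    obtain ⟨a, ha⟩ := w.exists_supportedIn
    have ha' : w.SupportedIn (m + a) (n + a) := ha.mono (by omega) (by omega)
    refine ⟨a, a, w.window (m + a) (n + a), (h w _ _ ha').1 hw, ?_⟩
    rw [← window_filterMap, window_add hv]
  · rintro ⟨a, b, y, hy, hxy⟩
    rw [← window_add hv] at hxy
    have hyw : (ofList y (m + a)).window (m + a) (n + b) = y := by
      apply window_ofList
      rw [← map_snd_window v, ← hxy]
      simp
    have hlen : y.length = m + a + (n + b) + 1 := by simpa using congrArg List.length hxy
    have hs := ofList_supportedIn y (m + a) (n + b) hlen.le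
    refine ⟨ofList y (m + a), ?_, (h _ _ _ hs).2 (by rwa [hyw])⟩
    refine eq_of_window_eq (hs.filterMap f) (hv.mono (by omega) (by omega)) ?_
    rw [window_filterMap, hyw, hxy]

end RegularPred

/-- A map between words that acts letter by letter. -/
@[fun_prop]
def Letterwise (F : ZWord X → ZWord α) : Prop := ∃ f : X → Option α, ∀ w, F w = w.filterMap f

@[fun_prop]
theorem letterwise_filterMap (f : X → Option α) : Letterwise fun w : ZWord X => w.filterMap f :=
  ⟨f, fun _ => rfl⟩

@[fun_prop]
theorem letterwise_id : Letterwise fun w : ZWord X => w :=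
  ⟨some, fun w => by ext1; funext k; simp⟩

@[fun_prop]
theorem Letterwise.comp {G : ZWord α → ZWord β} {F : ZWord X → ZWord α} (hG : Letterwise G)
    (hF : Letterwise F) : Letterwise fun w => G (F w) := by
  obtain ⟨g, hg⟩ := hG
  obtain ⟨f, hf⟩ := hF
  refine ⟨fun x => (f x).bind g, fun w => ?_⟩
  simp only [hg, hf]
  ext1
  funext k
  simp [Option.bind_assoc]

open Classical in
@[fun_prop]
theorem Letterwise.conv {F : ZWord X → ZWord α} {G : ZWord X → ZWord β} (hF : Letterwise F)
    (hG : Letterwise G) : Letterwise fun w => ZWord.conv (F w) (G w) := by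
  obtain ⟨f, hf⟩ := hF
  obtain ⟨g, hg⟩ := hG
  refine ⟨fun x => if f x = none ∧ g x = none then none else some (f x, g x), fun w => ?_⟩
  ext1
  funext k
  simp only [ZWord.conv, hf, hg, filterMap_apply]
  cases w k <;> simp

open Classical in
theorem Letterwise.convTuple {h : ℕ} {F : Fin h → ZWord X → ZWord α} (hF : ∀ i, Letterwise (F i)) :
    Letterwise fun w => ZWord.convTuple fun i => F i w := by
  choose f hf using hF
  refine ⟨fun x => if ∀ i, f i x = none then none else some fun i => f i x, fun w => ?_⟩
  ext1
  funext k
  simp only [ZWord.convTuple, hf, filterMap_apply]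
  cases w k <;> simp

theorem RegularPred.comp {P : ZWord α → Prop} (hP : RegularPred P) {F : ZWord X → ZWord α}
    (hF : Letterwise F) : RegularPred fun w => P (F w) := by
  obtain ⟨f, hf⟩ := hF
  exact (hP.filterMap f).congr fun w => by rw [hf]

@[simp] theorem filterMap_fst_conv (v : ZWord α) (w : ZWord β) :
    (v.conv w).filterMap Prod.fst = v := by
  ext1
  funext k
  by_cases h : v k = none ∧ w k = none <;> simp [ZWord.conv, h]

@[simp] theorem filterMap_snd_conv (v : ZWord α) (w : ZWord β) :
    (v.conv w).filterMap Prod.snd = w := by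
  ext1
  funext k
  by_cases h : v k = none ∧ w k = none <;> simp [ZWord.conv, h]

@[simp] theorem filterMap_apply_convTuple {h : ℕ} (x : Fin h → ZWord α) (i : Fin h) :
    (ZWord.convTuple x).filterMap (fun a => a i) = x i := by
  ext1
  funext k
  by_cases hx : ∀ i, x i k = none <;> simp [ZWord.convTuple, hx]

theorem convTuple_injective {h : ℕ} :
    Function.Injective (ZWord.convTuple : (Fin h → ZWord α) → ZWord (Fin h → Option α)) :=
  fun x y hxy => funext fun i => by
    rw [← filterMap_apply_convTuple x, hxy, filterMap_apply_convTuple]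

/-- The quantifier is a projection. The projected words need not be genuine convolutions, which is
harmless as the predicate sees only the two components. -/
theorem RegularPred.exists {P : ZWord X → ZWord β → Prop}
    (h : RegularPred fun w : ZWord (Option X × Option β) =>
      P (w.filterMap Prod.fst) (w.filterMap Prod.snd)) :
    RegularPred fun w => ∃ v, P w v :=
  (h.exists_filterMap_eq Prod.fst).congr fun w => by
    constructor
    · rintro ⟨v, hv⟩
      exact ⟨w.conv v, by simp, by simpa using hv⟩
    · rintro ⟨v, rfl, hv⟩
      exact ⟨_, hv⟩

theorem RegularPred.forall {P : ZWord X → ZWord β → Prop}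
    (h : RegularPred fun w : ZWord (Option X × Option β) =>
      P (w.filterMap Prod.fst) (w.filterMap Prod.snd)) :
    RegularPred fun w => ∀ v, P w v :=
  h.not.exists (P := fun w v => ¬ P w v) |>.not.congr fun w => by simp

/-! ### Local conditions on neighbouring symbols -/

/-- Whether a position is nonnegative, whether it is nonnegative and even, whether it is `0`. -/
def posClass (k : ℤ) : Bool × Bool × Bool :=
  (decide (0 ≤ k), decide (0 ≤ k ∧ k % 2 = 0), decide (k = 0))

/-- The class of the next position depends only on the current class and the flag of position `0`,
so an automaton can track it; parity alternates once `0` has been passed. -/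
theorem posClass_add_one (k : ℤ) :
    posClass (k + 1) = ((posClass k).1 || decide (k + 1 = 0),
      decide (k + 1 = 0) || ((posClass k).1 && !(posClass k).2.1), decide (k + 1 = 0)) := by
  simp only [posClass, Prod.mk.injEq, Bool.decide_and]
  refine ⟨?_, ?_, trivial⟩ <;> rw [Bool.eq_iff_iff] <;> simp <;> omega

open Classical in
/-- The automaton that compares each symbol with the previous one. -/
def localDFA (φ : (Bool × Bool × Bool) × Option X → (Bool × Bool × Bool) × Option X → Prop) :
    DFA (Option X × Bool) (Option ((Bool × Bool × Bool) × Option X)) where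
  step s a := s.bind fun q =>
    let q' := ((q.1.1 || a.2, a.2 || (q.1.1 && !q.1.2.1), a.2), a.1)
    if φ q q' then some q' else none
  -- The start state stands for the blank just before the window; acceptance compares the last
  -- symbol with the blank just after it. The state `none` records a violation.
  start := some ((false, false, false), none)
  accept := {s | ∃ q, s = some q ∧ φ q ((q.1.1, q.1.1 && !q.1.2.1, false), none)}

-- The run invariant: unless some pair has failed, the state is the class and the symbol of the last
-- position read.
open Classical in
theorem eval_localDFA
    (φ : (Bool × Bool × Bool) × Option X → (Bool × Bool × Bool) × Option X → Prop)
    (w : ZWord X) (m : ℕ) (hm : w (-1 - m) = none) (j : ℕ) :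
    (localDFA φ).eval ((List.range j).map fun i : ℕ => (w ((i : ℤ) - m), decide (i = m))) =
      if ∀ i < j, φ (posClass ((i : ℤ) - 1 - m), w ((i : ℤ) - 1 - m))
        (posClass ((i : ℤ) - m), w ((i : ℤ) - m))
      then some (posClass ((j : ℤ) - 1 - m), w ((j : ℤ) - 1 - m)) else none := by
  induction j with
  | zero =>
    have : posClass (-1 - (m : ℤ)) = (false, false, false) := by
      simp only [posClass, Prod.mk.injEq, decide_eq_false_iff_not]
      omega
    simp [hm, localDFA, this]
  | succ j ih =>
    rw [List.range_succ, List.map_append, List.map_singleton, DFA.eval_append_singleton, ih]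
    have hcls := posClass_add_one ((j : ℤ) - 1 - m)
    rw [show (j : ℤ) - 1 - m + 1 = j - m by ring] at hcls
    have hdec : decide ((j : ℤ) - m = 0) = decide (j = m) := by
      rw [decide_eq_decide]
      omega
    rw [hdec] at hcls
    have e : ((j + 1 : ℕ) : ℤ) - 1 - m = j - m := by push_cast; ring
    rw [e]
    by_cases h : ∀ i < j, φ (posClass ((i : ℤ) - 1 - m), w ((i : ℤ) - 1 - m))
        (posClass ((i : ℤ) - m), w ((i : ℤ) - m))
    · rw [if_pos h]
      simp only [localDFA, Option.bind_some]
      rw [← hcls]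
      refine if_congr ?_ rfl rfl
      constructor
      · intro h' i hi
        rcases Nat.lt_succ_iff_lt_or_eq.1 hi with hi | rfl
        exacts [h i hi, h']
      · intro h'
        exact h' j (Nat.lt_succ_self j)
    · rw [if_neg h, if_neg fun h' => h fun i hi => h' i (by omega)]
      rfl

/-- A condition on neighbouring symbols is regular. -/
theorem regularPred_local [Finite X]
    (φ : (Bool × Bool × Bool) × Option X → (Bool × Bool × Bool) × Option X → Prop)
    (hφ : ∀ c c', φ (c, none) (c', none)) :
    RegularPred fun w : ZWord X =>
      ∀ k : ℤ, φ (posClass k, w k) (posClass (k + 1), w (k + 1)) := by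
  have := Fintype.ofFinite (Option ((Bool × Bool × Bool) × Option X))
  refine ⟨(localDFA φ).accepts, ⟨_, this, _, rfl⟩, fun w m n hw => ?_⟩
  have hout : ∀ k : ℤ, ¬ (-(m : ℤ) ≤ k ∧ k ≤ n) → w k = none := fun k hk =>
    by_contra fun h => hk (hw k h)
  rw [DFA.mem_accepts, window_eq, eval_localDFA φ w m (hout _ (by omega))]
  have hcls := posClass_add_one (n : ℤ)
  rw [show decide ((n : ℤ) + 1 = 0) = false by simp; omega, Bool.or_false, Bool.false_or] at hcls
  have e : ((m + n + 1 : ℕ) : ℤ) - 1 - m = n := by push_cast; ring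
  rw [e]
  constructor
  · intro h
    rw [if_pos fun i _ => ?_]
    · refine ⟨_, rfl, ?_⟩
      rw [← hcls, ← hout (n + 1) (by omega)]
      exact h n
    · have := h ((i : ℤ) - 1 - m)
      rwa [show (i : ℤ) - 1 - m + 1 = i - m by ring] at this
  · rintro ⟨q, hq, hφq⟩ k
    split_ifs at hq with h
    obtain rfl := Option.some.inj hq
    rw [← hcls, ← hout (n + 1) (by omega)] at hφq
    by_cases hk : k = n
    · rwa [hk]
    · by_cases hk' : -1 - (m : ℤ) ≤ k ∧ k < n
      · have := h (k + 1 + m).toNat (by omega)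
        rwa [show (((k + 1 + m).toNat : ℕ) : ℤ) = k + 1 + m by omega,
          show k + 1 + (m : ℤ) - 1 - m = k by ring, show k + 1 + (m : ℤ) - m = k + 1 by ring] at this
      -- Both positions lie outside the window, so this is the blank–blank case.
      · rw [hout k (by omega), hout (k + 1) (by omega)]
        exact hφ _ _

theorem regularPred_forall_letter [Finite X] (φ : Bool × Bool × Bool → Option X → Prop)
    (hφ : ∀ c, φ c none) : RegularPred fun w : ZWord X => ∀ k : ℤ, φ (posClass k) (w k) :=
  regularPred_local (fun q _ => φ q.1 q.2) fun c _ => hφ c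

theorem RegularPred.eq [Finite X] {F G : ZWord X → ZWord α} (hF : Letterwise F)
    (hG : Letterwise G) : RegularPred fun w => F w = G w := by
  obtain ⟨f, hf⟩ := hF
  obtain ⟨g, hg⟩ := hG
  refine (regularPred_forall_letter (fun _ o => o.bind f = o.bind g) (by simp)).congr fun w => ?_
  rw [hf, hg, ZWord.ext_iff, funext_iff]
  rfl

/-! ### Shifts and constant words -/

namespace ZWord

/-- The word `w` moved by `j` positions to the left. -/
def shift (j : ℤ) (w : ZWord α) : ZWord α where
  toFun k := w (k + j)
  finite_dom := w.finite_dom.preimage (f := fun k => k + j) (add_left_injective j).injOn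

/-- The word `w` without its symbol at the position `0`. -/
def eraseZero (w : ZWord α) : ZWord α where
  toFun k := if k = 0 then none else w k
  finite_dom := w.finite_dom.subset fun k hk => by
    simp only [mem_ofPred_eq] at hk ⊢
    intro h
    simp [h] at hk

end ZWord

/-- The shifted word is guessed; that the guess is correct is a local condition. -/
theorem RegularPred.shift_one [Finite X] {P : ZWord X → Prop} (hP : RegularPred P) :
    RegularPred fun w => P (w.shift 1) := by
  have h := (regularPred_local (X := Option X × Option X)
    (fun q q' => q.2.bind Prod.snd = q'.2.bind Prod.fst) (by simp)).and (hP.filterMap Prod.snd)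
  refine (RegularPred.exists (P := fun w v => (∀ k, v k = w (k + 1)) ∧ P v) h).congr fun w => ?_
  constructor
  · intro h
    exact ⟨_, fun k => rfl, h⟩
  · rintro ⟨v, hv, h⟩
    rwa [show w.shift 1 = v from ZWord.ext (funext fun k => (hv k).symm)]

theorem RegularPred.shift_neg_one [Finite X] {P : ZWord X → Prop} (hP : RegularPred P) :
    RegularPred fun w => P (w.shift (-1)) := by
  have h := (regularPred_local (X := Option X × Option X)
    (fun q q' => q.2.bind Prod.fst = q'.2.bind Prod.snd) (by simp)).and (hP.filterMap Prod.snd)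
  refine (RegularPred.exists (P := fun w v => (∀ k, w k = v (k + 1)) ∧ P v) h).congr fun w => ?_
  constructor
  · intro h
    exact ⟨w.shift (-1), fun k => by simp [ZWord.shift], h⟩
  · rintro ⟨v, hv, h⟩
    have : w.shift (-1) = v := ZWord.ext (funext fun k => by
      have := hv (k + -1)
      simpa [ZWord.shift] using this)
    rwa [this]

theorem RegularPred.shift [Finite X] {P : ZWord X → Prop} (hP : RegularPred P) (j : ℤ) :
    RegularPred fun w => P (w.shift j) := by
  induction j using Int.induction_on generalizing P with
  | zero => exact hP.congr fun w => by simp [ZWord.shift]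
  | succ i ih =>
    refine (ih hP.shift_one).congr fun w => iff_of_eq (congrArg P ?_)
    ext1; funext k; simp only [ZWord.shift]; congr 1; ring
  | pred i ih =>
    refine (ih hP.shift_neg_one).congr fun w => iff_of_eq (congrArg P ?_)
    ext1; funext k; simp only [ZWord.shift]; congr 1; ring

theorem RegularPred.eraseZero [Finite X] {P : ZWord X → Prop} (hP : RegularPred P) :
    RegularPred fun w => P w.eraseZero := by
  have h := (regularPred_forall_letter (X := Option X × Option X)
    (fun c o => o.bind Prod.snd = if c.2.2 = true then none else o.bind Prod.fst)
    (by simp)).and (hP.filterMap Prod.snd)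
  refine (RegularPred.exists
    (P := fun w v => (∀ k, v k = if (posClass k).2.2 = true then none else w k) ∧ P v)
    h).congr fun w => ?_
  have e : ∀ k, w.eraseZero k = if (posClass k).2.2 = true then none else w k := fun k => by
    simp [ZWord.eraseZero, posClass]
  constructor
  · intro h
    exact ⟨_, e, h⟩
  · rintro ⟨v, hv, h⟩
    rwa [show w.eraseZero = v from ZWord.ext (funext fun k => by rw [e, hv])]

theorem regularPred_apply_zero [Finite X] (φ : Option X → Prop) :
    RegularPred fun w : ZWord X => φ (w 0) := by
  have h : ∀ a : Option X, a ≠ none → RegularPred fun w : ZWord X => w 0 ≠ a := fun a ha => by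
    refine (regularPred_forall_letter (X := X) (fun c o => c.2.2 = true → o ≠ a)
      (fun _ _ => ha.symm)).congr fun w => ⟨fun h k hk => ?_, fun h => h 0 rfl⟩
    simp only [posClass, decide_eq_true_eq] at hk
    rwa [hk]
  by_cases h0 : φ none
  · refine (regularPred_forall_letter (X := X) (fun c o => c.2.2 = true → φ o)
      (fun _ _ => h0)).congr fun w => ⟨fun h k hk => ?_, fun h => h 0 rfl⟩
    simp only [posClass, decide_eq_true_eq] at hk
    rwa [hk]
  · refine (regularPred_forall_letter (X := X) (fun c o => c.2.2 = true → ¬ φ o)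
      (fun _ _ => h0)).not.congr fun w => ⟨fun h h' => h' 0 rfl h, fun h => ?_⟩
    push Not at h
    obtain ⟨k, hk, h⟩ := h
    simp only [posClass, decide_eq_true_eq] at hk
    rwa [hk] at h

theorem regularPred_apply [Finite X] (φ : Option X → Prop) (j : ℤ) :
    RegularPred fun w : ZWord X => φ (w j) :=
  ((regularPred_apply_zero φ).shift j).congr fun w => by simp [ZWord.shift]

theorem ZWord.shift_injective (j : ℤ) : Function.Injective (ZWord.shift (α := α) j) :=
  fun v w h => ZWord.ext (funext fun k => by
    have := congrArg (fun u : ZWord α => u (k - j)) h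
    simpa [ZWord.shift] using this)

/-- Induction on the number of symbols: one of them is shifted to position `0`, tested there and
erased. -/
theorem regularPred_eq_const [Finite X] (c : ZWord X) : RegularPred fun w => w = c := by
  induction hn : {k | c k ≠ none}.ncard using Nat.strong_induction_on generalizing c with
  | _ n ih =>
    by_cases hc : ∃ j, c j ≠ none
    · obtain ⟨j, hj⟩ := hc
      have hlt : {k | (c.shift j).eraseZero k ≠ none}.ncard < n := by
        rw [← hn, ← ncard_image_of_injective _ (add_left_injective j)]
        refine ncard_lt_ncard ⟨?_, fun h => ?_⟩ c.finite_dom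
        · rintro _ ⟨k, hk, rfl⟩
          simp only [ZWord.eraseZero, ZWord.shift, mem_ofPred_eq] at hk ⊢
          split_ifs at hk
          · exact absurd rfl hk
          · exact hk
        · obtain ⟨k, hk, hkj⟩ := h hj
          obtain rfl : k = 0 := by simpa using hkj
          simp [ZWord.eraseZero] at hk
      refine ((regularPred_apply (fun o => o = c j) j).and
        ((ih _ hlt _ rfl).eraseZero.shift j)).congr fun w => ?_
      constructor
      · rintro rfl
        exact ⟨rfl, rfl⟩
      · rintro ⟨h₁, h₂⟩
        refine ZWord.shift_injective j (ZWord.ext (funext fun k => ?_))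
        by_cases hk : k = 0
        · simpa [hk, ZWord.shift] using h₁
        · have := congrArg (fun u : ZWord X => u k) h₂
          simpa [ZWord.eraseZero, hk] using this
    · push Not at hc
      refine (regularPred_forall_letter (X := X) (fun _ o => o = none) (fun _ => rfl)).congr
        fun w => ?_
      simp [ZWord.ext_iff, funext_iff, hc]

theorem RegularPred.const [Finite X] {P : Prop} : RegularPred fun _ : ZWord X => P := by
  by_cases h : P
  · exact (regularPred_forall_letter (X := X) (fun _ _ => True) (by simp)).congr fun w => by simp [h]
  · exact (regularPred_forall_letter (X := X) (fun _ _ => True) (by simp)).not.congr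
      fun w => by simp [h]

/-- A constant may be substituted for an argument of a regular predicate. -/
theorem RegularPred.subst_const [Finite β] {P : ZWord X → ZWord β → Prop} (c : ZWord β)
    (h : RegularPred fun w : ZWord (Option X × Option β) =>
      P (w.filterMap Prod.fst) (w.filterMap Prod.snd)) : RegularPred fun w => P w c := by
  refine (RegularPred.exists (P := fun w v => v = c ∧ P w v)
    (((regularPred_eq_const c).filterMap Prod.snd).and h)).congr fun w => by simp

theorem RegularPred.exists_finset {ι : Type*} [Finite X] (s : Finset ι) {P : ι → ZWord X → Prop}
    (h : ∀ i ∈ s, RegularPred (P i)) : RegularPred fun w => ∃ i ∈ s, P i w := by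
  classical
  induction s using Finset.induction_on with
  | empty => exact RegularPred.const.congr (P := fun _ => False) fun w => by simp
  | insert a s _ ih =>
    refine ((h a (by simp)).or (ih fun i hi => h i (by simp [hi]))).congr fun w => by simp

theorem RegularPred.forall_fin [Finite X] {h : ℕ} {P : Fin h → ZWord X → Prop}
    (hP : ∀ i, RegularPred (P i)) : RegularPred fun w => ∀ i, P i w :=
  (RegularPred.exists_finset Finset.univ fun i _ => (hP i).not).not.congr fun w => by simp

theorem RegularPred.exists_fintype {ι : Type*} [Finite ι] [Finite X] {P : ι → ZWord X → Prop}
    (hP : ∀ i, RegularPred (P i)) : RegularPred fun w => ∃ i, P i w := by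
  have := Fintype.ofFinite ι
  exact (RegularPred.exists_finset Finset.univ fun i _ => hP i).congr fun w => by simp

/-- A witness of a regular relation can be chosen such that its domain exceeds the domain of the
argument by a bounded number of positions only. -/
theorem RegularPred.exists_supportedIn {P : ZWord X → ZWord β → Prop}
    (h : RegularPred fun w : ZWord (Option X × Option β) =>
      P (w.filterMap Prod.fst) (w.filterMap Prod.snd)) :
    ∃ C, ∀ w m, w.SupportedIn m m → (∃ v, P w v) → ∃ v, v.SupportedIn (m + C) (m + C) ∧ P w v := by
  obtain ⟨_, ⟨σ, hσ, M, rfl⟩, hM⟩ := h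
  refine ⟨Fintype.card σ, fun w m hw => ?_⟩
  rintro ⟨v, hv⟩
  obtain ⟨a, ha⟩ := (w.conv v).exists_supportedIn
  have ha' : (w.conv v).SupportedIn (m + a) (m + a) := ha.mono (by omega) (by omega)
  have hacc := (hM _ _ _ ha').1 (by simpa using hv)
  set g : Option (Option X × Option β) × Bool → Option X × Bool :=
    Prod.map (fun o : Option (Option X × Option β) => o.bind Prod.fst) id with hg
  have hl : ((w.conv v).window (m + a) (m + a)).map g =
      List.replicate a (none, false) ++ w.window m m ++ List.replicate a (none, false) := by
    rw [hg, ← window_filterMap, filterMap_fst_conv, window_add hw]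
  obtain ⟨l₁₂, l₃, hl₁₂, h₁₂, h₃⟩ := List.map_eq_append_iff.1 hl
  obtain ⟨l₁, l₂, rfl, h₁, h₂⟩ := List.map_eq_append_iff.1 h₁₂
  -- `l₁` and `l₃` are the stretches outside the window of `w`, where only the witness is written.
  -- Both are pumped down to at most the number of states; `l₂` stays.
  obtain ⟨y₁, hs₁, hc₁, he₁⟩ := M.exists_shorter M.start l₁
  obtain ⟨y₃, hs₃, hc₃, he₃⟩ := M.exists_shorter (M.evalFrom M.start (l₁ ++ l₂)) l₃
  have hy : M.eval (y₁ ++ l₂ ++ y₃) ∈ M.accept := by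
    rw [hl₁₂, DFA.mem_accepts, DFA.eval, DFA.evalFrom_of_append, ← he₃, DFA.evalFrom_of_append,
      ← he₁] at hacc
    rwa [DFA.eval, DFA.evalFrom_of_append, DFA.evalFrom_of_append]
  -- The shortened ends still project to blanks, so the shortened word still projects to `w`.
  have hr : ∀ {y l : List (Option (Option X × Option β) × Bool)}, y.Sublist l →
      l.map g = List.replicate a (none, false) → y.map g = List.replicate y.length (none, false) := by
    intro y l hyl hl
    have := hyl.map g
    rw [hl, List.sublist_replicate_iff] at this
    obtain ⟨n, -, hn⟩ := this
    have hlen := congrArg List.length hn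
    simp only [List.length_map, List.length_replicate] at hlen
    rw [hn, hlen]
  have hmap : (y₁ ++ l₂ ++ y₃).map g = w.window (m + y₁.length) (m + y₃.length) := by
    rw [window_add hw, List.map_append, List.map_append, hr hs₁ h₁, hr hs₃ h₃, h₂]
  have hwin := window_ofList (y₁ ++ l₂ ++ y₃) (m + y₁.length) (m + y₃.length) (by
    rw [← map_snd_window w, ← hmap, List.map_map]
    rfl)
  set u := ofList (y₁ ++ l₂ ++ y₃) (m + y₁.length) with hu
  have hlen := congrArg List.length hwin
  rw [length_window] at hlen
  have hsu : u.SupportedIn (m + y₁.length) (m + y₃.length) := ofList_supportedIn _ _ _ hlen.ge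
  have hw' : u.filterMap Prod.fst = w := by
    refine eq_of_window_eq (hsu.filterMap _) (hw.mono (by omega) (by omega)) ?_
    rw [window_filterMap, hwin, ← hmap]
  refine ⟨u.filterMap Prod.snd, (hsu.mono (by omega) (by omega)).filterMap _, ?_⟩
  have := (hM u _ _ hsu).2 (by rw [hwin]; exact hy)
  rw [mem_ofPred_eq, hw'] at this
  exact this

@[fun_prop]
theorem Letterwise.convTuple_pair {F G : ZWord X → ZWord α} (hF : Letterwise F)
    (hG : Letterwise G) : Letterwise fun w => ZWord.convTuple ![F w, G w] := by
  have h := Letterwise.convTuple (F := ![F, G]) (by simp [Fin.forall_fin_two, hF, hG])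
  convert h using 3 with w i
  ext i
  fin_cases i <;> rfl

theorem IsAutomaticRel.regularPred {h : ℕ} {R : Set (Fin h → ZWord α)} (hR : IsAutomaticRel R)
    {F : Fin h → ZWord X → ZWord α} (hF : ∀ i, Letterwise (F i)) :
    RegularPred fun w => (fun i => F i w) ∈ R :=
  (IsRegularSet.regularPred hR |>.comp (Letterwise.convTuple hF)).congr fun _ =>
    (convTuple_injective.mem_set_image).symm

/-- Besides the condition on its components, a word must be the convolution of these components;
this is a letterwise equation. -/
theorem isAutomaticRel_of_regularPred [Finite α] {h : ℕ} {R : Set (Fin h → ZWord α)}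
    (hR : RegularPred fun w : ZWord (Fin h → Option α) => (fun i => w.filterMap fun a => a i) ∈ R) :
    IsAutomaticRel R := by
  refine (hR.and (RegularPred.eq letterwise_id (Letterwise.convTuple (F := fun i w =>
    w.filterMap fun a => a i) fun i => letterwise_filterMap _))).congr fun w => ?_
  constructor
  · rintro ⟨x, hx, rfl⟩
    simpa using hx
  · rintro ⟨h₁, h₂⟩
    exact ⟨_, h₁, h₂.symm⟩

theorem Letterwise.matrix_two {F G : ZWord X → ZWord α} (hF : Letterwise F) (hG : Letterwise G)
    (i : Fin 2) : Letterwise (![F, G] i) := by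
  fin_cases i <;> assumption

/-! ### Rectangles of a grid -/

section Grid

variable {A : Set (ZWord α)} {val : ZWord α → ℝ}

theorem IsGrid.regularPred_mem (hA : IsGrid A val) {F : ZWord X → ZWord α} (hF : Letterwise F) :
    RegularPred fun w => F w ∈ A :=
  hA.domain.regularPred.comp hF

theorem IsGrid.regularPred_add (hA : IsGrid A val) {F G H : ZWord X → ZWord α}
    (hF : Letterwise F) (hG : Letterwise G) (hH : Letterwise H) :
    RegularPred fun w => (F w ∈ A ∧ G w ∈ A ∧ H w ∈ A) ∧ val (F w) + val (G w) = val (H w) :=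
  (hA.add.regularPred (F := ![F, G, H]) fun i => by fin_cases i <;> assumption).congr fun w => by
    simp [Fin.forall_fin_succ]

theorem IsGrid.regularPred_lt (hA : IsGrid A val) {F G : ZWord X → ZWord α}
    (hF : Letterwise F) (hG : Letterwise G) :
    RegularPred fun w => (F w ∈ A ∧ G w ∈ A) ∧ val (F w) < val (G w) :=
  (hA.lt.regularPred (hF.matrix_two hG)).congr fun w => by simp [Fin.forall_fin_succ]

theorem IsGrid.regularPred_le (hA : IsGrid A val) {F G : ZWord X → ZWord α}
    (hF : Letterwise F) (hG : Letterwise G) :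
    RegularPred fun w => (F w ∈ A ∧ G w ∈ A) ∧ val (F w) ≤ val (G w) :=
  (((hA.regularPred_mem hF).and (hA.regularPred_mem hG)).and
    (hA.regularPred_lt hG hF).not).congr fun w => by
      rw [← not_lt]
      tauto

theorem IsGrid.exists_word (hA : IsGrid A val) :
    ∃ S : Subring ℝ, ∀ x, x ∈ S ↔ ∃ w ∈ A, val w = x := by
  obtain ⟨S, hS, -⟩ := hA.dense_subring
  exact ⟨S, fun x => by rw [← SetLike.mem_coe, ← hS]; rfl⟩

variable {D : Set (ZWord Γ)} {E : ZWord Γ → Set (ℝ × ℝ)}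

theorem IsAutomaticRectangleFamily.regularPred_mem (hE : IsAutomaticRectangleFamily A val D E)
    {F G : ZWord X → ZWord α} {H : ZWord X → ZWord Γ} (hF : Letterwise F) (hG : Letterwise G)
    (hH : Letterwise H) :
    RegularPred fun w => H w ∈ D ∧ F w ∈ A ∧ G w ∈ A ∧ (val (F w), val (G w)) ∈ E (H w) := by
  refine (hE.automatic.members.regularPred.comp (F := fun w =>
    ZWord.conv (H w) (ZWord.convTuple ![F w, G w])) (by fun_prop)).congr fun w => ?_
  constructor
  · rintro ⟨hd, hv, hw, h⟩
    exact ⟨_, hd, _, ⟨_, hv, _, hw, h, rfl⟩, rfl⟩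
  · rintro ⟨d, hd, _, ⟨v, hv, u, hu, h, rfl⟩, hconv⟩
    have h₁ : H w = d := by
      rw [← filterMap_fst_conv (H w), hconv, filterMap_fst_conv]
    have h₂ : ZWord.convTuple ![F w, G w] = ZWord.convTuple ![v, u] := by
      rw [← filterMap_snd_conv (H w) (ZWord.convTuple ![F w, G w]), hconv, filterMap_snd_conv]
    have h₃ := convTuple_injective h₂
    have h₄ : F w = v := congrFun h₃ 0
    have h₅ : G w = u := congrFun h₃ 1
    rw [h₁, h₄, h₅]
    exact ⟨hd, hv, hu, h⟩

/-- The corners of both rectangles are themselves grid points, so testing them already forces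
equality; density of the grid is not needed. -/
theorem IsAutomaticRectangleFamily.eq_rectangle_iff (hE : IsAutomaticRectangleFamily A val D E)
    {x₁ x₂ y₁ y₂ : ZWord α} (hx₁ : x₁ ∈ A) (hx₂ : x₂ ∈ A) (hy₁ : y₁ ∈ A) (hy₂ : y₂ ∈ A)
    (hx : val x₁ < val x₂) (hy : val y₁ < val y₂) {d : ZWord Γ} (hd : d ∈ D) :
    E d = Icc (val x₁) (val x₂) ×ˢ Icc (val y₁) (val y₂) ↔
      ∀ v ∈ A, ∀ w ∈ A, ((val v, val w) ∈ E d ↔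
        (val x₁ ≤ val v ∧ val v ≤ val x₂) ∧ (val y₁ ≤ val w ∧ val w ≤ val y₂)) := by
  constructor
  · intro h v _ w _
    rw [h]
    rfl
  · intro h
    obtain ⟨_, ⟨a, ha, rfl⟩, _, ⟨b, hb, rfl⟩, _, ⟨a', ha', rfl⟩, _, ⟨b', hb', rfl⟩, hab, hab', hEd⟩ :=
      hE.all_rectangles.subset ⟨d, hd, rfl⟩
    rw [hEd] at h ⊢
    simp only [mem_prod, mem_Icc] at h
    have h₁ := (h a ha a' ha').1 ⟨⟨le_rfl, hab.le⟩, le_rfl, hab'.le⟩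
    have h₂ := (h b hb b' hb').1 ⟨⟨hab.le, le_rfl⟩, hab'.le, le_rfl⟩
    have h₃ := (h x₁ hx₁ y₁ hy₁).2 ⟨⟨le_rfl, hx.le⟩, le_rfl, hy.le⟩
    have h₄ := (h x₂ hx₂ y₂ hy₂).2 ⟨⟨hx.le, le_rfl⟩, hy.le, le_rfl⟩
    rw [le_antisymm h₁.1.1 h₃.1.1, le_antisymm h₂.1.2 h₄.1.2, le_antisymm h₁.2.1 h₃.2.1,
      le_antisymm h₂.2.2 h₄.2.2]

/-- The properties of a rectangle that is given by its corner words and by an index. -/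
structure IsRectangle (A : Set (ZWord α)) (val : ZWord α → ℝ) (D : Set (ZWord Γ))
    (E : ZWord Γ → Set (ℝ × ℝ)) (x₁ x₂ y₁ y₂ : ZWord α) (d : ZWord Γ) : Prop where
  mem_x₁ : x₁ ∈ A
  mem_x₂ : x₂ ∈ A
  mem_y₁ : y₁ ∈ A
  mem_y₂ : y₂ ∈ A
  lt_x : val x₁ < val x₂
  lt_y : val y₁ < val y₂
  index_mem : d ∈ D
  eq : E d = Icc (val x₁) (val x₂) ×ˢ Icc (val y₁) (val y₂)

theorem IsRectangle.volume_eq {x₁ x₂ y₁ y₂ : ZWord α} {d : ZWord Γ}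
    (h : IsRectangle A val D E x₁ x₂ y₁ y₂ d) :
    volume (E d) = ENNReal.ofReal ((val x₂ - val x₁) * (val y₂ - val y₁)) := by
  rw [h.eq, Measure.volume_eq_prod, Measure.prod_prod, Real.volume_Icc, Real.volume_Icc,
    ENNReal.ofReal_mul (sub_nonneg.2 h.lt_x.le)]

theorem IsAutomaticRectangleFamily.exists_corners (hE : IsAutomaticRectangleFamily A val D E)
    {d : ZWord Γ} (hd : d ∈ D) : ∃ x₁ x₂ y₁ y₂, IsRectangle A val D E x₁ x₂ y₁ y₂ d := by
  obtain ⟨_, ⟨a, ha, rfl⟩, _, ⟨b, hb, rfl⟩, _, ⟨a', ha', rfl⟩, _, ⟨b', hb', rfl⟩, hab, hab', hEd⟩ :=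
      hE.all_rectangles.subset ⟨d, hd, rfl⟩
  exact ⟨a, b, a', b', ha, hb, ha', hb', hab, hab', hd, hEd⟩

theorem IsAutomaticRectangleFamily.exists_index (hE : IsAutomaticRectangleFamily A val D E)
    {x₁ x₂ y₁ y₂ : ZWord α} (hx₁ : x₁ ∈ A) (hx₂ : x₂ ∈ A) (hy₁ : y₁ ∈ A) (hy₂ : y₂ ∈ A)
    (hx : val x₁ < val x₂) (hy : val y₁ < val y₂) : ∃ d, IsRectangle A val D E x₁ x₂ y₁ y₂ d := by
  obtain ⟨d, hd, h⟩ := hE.all_rectangles.superset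
    ⟨_, ⟨x₁, hx₁, rfl⟩, _, ⟨x₂, hx₂, rfl⟩, _, ⟨y₁, hy₁, rfl⟩, _, ⟨y₂, hy₂, rfl⟩, hx, hy, rfl⟩
  exact ⟨d, hx₁, hx₂, hy₁, hy₂, hx, hy, hd, h⟩

/-- This translates between the indices of an arbitrary automatic family and corner words. Equality
of the rectangles becomes, by `eq_rectangle_iff`, a quantification over grid points. -/
theorem IsGrid.regularPred_isRectangle (hA : IsGrid A val)
    (hE : IsAutomaticRectangleFamily A val D E) {F₁ F₂ G₁ G₂ : ZWord X → ZWord α}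
    {H : ZWord X → ZWord Γ} (hF₁ : Letterwise F₁) (hF₂ : Letterwise F₂) (hG₁ : Letterwise G₁)
    (hG₂ : Letterwise G₂) (hH : Letterwise H) :
    RegularPred fun w => IsRectangle A val D E (F₁ w) (F₂ w) (G₁ w) (G₂ w) (H w) := by
  have h : RegularPred fun w => ∀ u v, u ∈ A → v ∈ A →
      ((H w ∈ D ∧ u ∈ A ∧ v ∈ A ∧ (val u, val v) ∈ E (H w)) ↔
        ((((F₁ w ∈ A ∧ u ∈ A) ∧ val (F₁ w) ≤ val u) ∧ ((u ∈ A ∧ F₂ w ∈ A) ∧ val u ≤ val (F₂ w))) ∧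
        (((G₁ w ∈ A ∧ v ∈ A) ∧ val (G₁ w) ≤ val v) ∧
          ((v ∈ A ∧ G₂ w ∈ A) ∧ val v ≤ val (G₂ w))))) := by
    refine RegularPred.forall (RegularPred.forall ?_)
    refine (hA.regularPred_mem (by fun_prop)).imp ((hA.regularPred_mem (by fun_prop)).imp
      ((hE.regularPred_mem (by fun_prop) (by fun_prop) (by fun_prop)).iff
      (((hA.regularPred_le (by fun_prop) (by fun_prop)).and
      (hA.regularPred_le (by fun_prop) (by fun_prop))).and
      ((hA.regularPred_le (by fun_prop) (by fun_prop)).and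
      (hA.regularPred_le (by fun_prop) (by fun_prop))))))
  refine ((((hE.automatic.index.regularPred.comp hH).and (hA.regularPred_lt hF₁ hF₂)).and
    (hA.regularPred_lt hG₁ hG₂)).and h).congr fun w => ?_
  constructor
  · intro hr
    refine ⟨⟨⟨hr.index_mem, ⟨hr.mem_x₁, hr.mem_x₂⟩, hr.lt_x⟩, ⟨hr.mem_y₁, hr.mem_y₂⟩, hr.lt_y⟩,
      fun u v hu hv => ?_⟩
    have := (hE.eq_rectangle_iff hr.mem_x₁ hr.mem_x₂ hr.mem_y₁ hr.mem_y₂ hr.lt_x hr.lt_y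
      hr.index_mem).1 hr.eq u hu v hv
    simp only [hu, hv, hr.mem_x₁, hr.mem_x₂, hr.mem_y₁, hr.mem_y₂, hr.index_mem, true_and, this,
      and_self]
  · rintro ⟨⟨⟨hd, ⟨hx₁, hx₂⟩, hx⟩, ⟨hy₁, hy₂⟩, hy⟩, h⟩
    refine ⟨hx₁, hx₂, hy₁, hy₂, hx, hy, hd,
      (hE.eq_rectangle_iff hx₁ hx₂ hy₁ hy₂ hx hy hd).2 fun u hu v hv => ?_⟩
    have := h u v hu hv
    simpa only [hu, hv, hx₁, hx₂, hy₁, hy₂, hd, true_and, and_self] using this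

/-- The index of a rectangle is the convolution of its four corner words. -/
theorem IsGrid.exists_isAutomaticRectangleFamily [Finite α] (hA : IsGrid A val) :
    ∃ (Γ : Type) (_ : Finite Γ) (D : Set (ZWord Γ)) (E : ZWord Γ → Set (ℝ × ℝ)),
      IsAutomaticRectangleFamily A val D E := by
  set R : Set (Fin 4 → ZWord α) := {x | ((x 0 ∈ A ∧ x 1 ∈ A) ∧ val (x 0) < val (x 1)) ∧
    ((x 2 ∈ A ∧ x 3 ∈ A) ∧ val (x 2) < val (x 3))} with hR
  have hRa : IsAutomaticRel R := isAutomaticRel_of_regularPred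
    ((hA.regularPred_lt (by fun_prop) (by fun_prop)).and
      (hA.regularPred_lt (by fun_prop) (by fun_prop)))
  set E : ZWord (Fin 4 → Option α) → Set (ℝ × ℝ) := fun d =>
    Icc (val (d.filterMap fun a => a 0)) (val (d.filterMap fun a => a 1)) ×ˢ
      Icc (val (d.filterMap fun a => a 2)) (val (d.filterMap fun a => a 3)) with hE
  have hEx : ∀ x, E (ZWord.convTuple x) =
      Icc (val (x 0)) (val (x 1)) ×ˢ Icc (val (x 2)) (val (x 3)) := fun x => by
    simp only [hE, filterMap_apply_convTuple]
  refine ⟨Fin 4 → Option α, inferInstance, ZWord.convTuple '' R, E, ?_, hRa, ?_⟩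
  · ext r
    constructor
    · rintro ⟨_, ⟨x, ⟨⟨⟨h₀, h₁⟩, h₀₁⟩, ⟨h₂, h₃⟩, h₂₃⟩, rfl⟩, rfl⟩
      exact ⟨_, ⟨_, h₀, rfl⟩, _, ⟨_, h₁, rfl⟩, _, ⟨_, h₂, rfl⟩, _, ⟨_, h₃, rfl⟩, h₀₁, h₂₃, hEx x⟩
    · rintro ⟨_, ⟨a, ha, rfl⟩, _, ⟨b, hb, rfl⟩, _, ⟨a', ha', rfl⟩, _, ⟨b', hb', rfl⟩, hab, hab', rfl⟩
      exact ⟨_, ⟨![a, b, a', b'], ⟨⟨⟨ha, hb⟩, hab⟩, ⟨ha', hb'⟩, hab'⟩, rfl⟩, hEx _⟩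
  · have hD : RegularPred fun d => d ∈ ZWord.convTuple '' R := IsRegularSet.regularPred hRa
    set f : Fin 4 → (ZWord (Option (Fin 4 → Option α) × Option (Fin 2 → Option α)) → ZWord α) :=
      fun i u => (u.filterMap Prod.fst).filterMap fun a => a i with hf
    set g : Fin 2 → (ZWord (Option (Fin 4 → Option α) × Option (Fin 2 → Option α)) → ZWord α) :=
      fun i u => (u.filterMap Prod.snd).filterMap fun a => a i with hg
    have hfl : ∀ i, Letterwise (f i) := fun i => by fun_prop
    have hgl : ∀ i, Letterwise (g i) := fun i => by fun_prop
    have hreg := ((hD.filterMap Prod.fst).and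
      (((hA.regularPred_le (hfl 0) (hgl 0)).and (hA.regularPred_le (hgl 0) (hfl 1))).and
      ((hA.regularPred_le (hfl 2) (hgl 1)).and (hA.regularPred_le (hgl 1) (hfl 3))))).and
      ((RegularPred.eq (F := fun u => u.filterMap Prod.snd) (by fun_prop)
        ((hgl 0).convTuple_pair (hgl 1))).and (RegularPred.eq letterwise_id
        ((letterwise_filterMap Prod.fst).conv (letterwise_filterMap Prod.snd))))
    refine hreg.congr fun u => ?_
    constructor
    · rintro ⟨d, ⟨x, ⟨⟨⟨h₀, h₁⟩, h₀₁⟩, ⟨h₂, h₃⟩, h₂₃⟩, rfl⟩, _, ⟨v, hv, w, hw, h, rfl⟩, rfl⟩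
      rw [hEx] at h
      obtain ⟨⟨ha, hb⟩, hc, hd⟩ := h
      simp only [hf, hg, filterMap_fst_conv, filterMap_snd_conv, filterMap_apply_convTuple]
      exact ⟨⟨⟨x, ⟨⟨⟨h₀, h₁⟩, h₀₁⟩, ⟨h₂, h₃⟩, h₂₃⟩, rfl⟩, ⟨⟨⟨h₀, hv⟩, ha⟩, ⟨hv, h₁⟩, hb⟩,
        ⟨⟨h₂, hw⟩, hc⟩, ⟨hw, h₃⟩, hd⟩, rfl, trivial⟩
    · rintro ⟨⟨hd, ⟨⟨⟨-, hv⟩, h₁⟩, -, h₂⟩, ⟨⟨-, hw⟩, h₃⟩, -, h₄⟩, h₅, h₆⟩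
      exact ⟨_, hd, _, ⟨_, hv, _, hw, ⟨⟨h₁, h₂⟩, h₃, h₄⟩, h₅⟩, h₆⟩

end Grid

/-! ### Growth: equality of areas is not automatic -/

theorem ncard_supportedIn_le [Finite α] (r : ℕ) :
    {w : ZWord α | w.SupportedIn r r}.Finite ∧
      {w : ZWord α | w.SupportedIn r r}.ncard ≤ Nat.card (Option α) ^ (2 * r + 1) := by
  set f : ZWord α → (Fin (2 * r + 1) → Option α) := fun w i => w ((i : ℤ) - r) with hf
  have hinj : InjOn f {w : ZWord α | w.SupportedIn r r} := by
    intro v hv w hw h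
    ext1
    funext k
    by_cases hk : -(r : ℤ) ≤ k ∧ k ≤ r
    · have := congrFun h ⟨(k + r).toNat, by omega⟩
      simp only [hf] at this
      rwa [show (((k + r).toNat : ℕ) : ℤ) - r = k by omega] at this
    · rw [show v k = none from by_contra fun h => hk (hv k h),
        show w k = none from by_contra fun h => hk (hw k h)]
  refine ⟨Set.Finite.of_finite_image (toFinite _) hinj, ?_⟩
  refine (ncard_le_ncard_of_injOn (t := univ) f (fun _ _ => mem_univ _) hinj).trans ?_
  rw [ncard_univ, Nat.card_fun, Nat.card_fin]

section Growth

variable {A : Set (ZWord α)} {val : ZWord α → ℝ}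

/-- The values of the words of `A` that are supported in `[-r, r]`. -/
def boundedValues (A : Set (ZWord α)) (val : ZWord α → ℝ) (r : ℕ) : Set ℝ :=
  val '' {w ∈ A | w.SupportedIn r r}

theorem boundedValues_mono {r s : ℕ} (h : r ≤ s) :
    boundedValues A val r ⊆ boundedValues A val s := by
  rintro _ ⟨w, ⟨hw, hs⟩, rfl⟩
  exact ⟨w, ⟨hw, hs.mono h h⟩, rfl⟩

theorem ncard_boundedValues_le [Finite α] (r : ℕ) :
    (boundedValues A val r).Finite ∧
      (boundedValues A val r).ncard ≤ Nat.card (Option α) ^ (2 * r + 1) := by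
  obtain ⟨hf, hc⟩ := ncard_supportedIn_le (α := α) r
  have hsub : {w ∈ A | w.SupportedIn r r} ⊆ {w | w.SupportedIn r r} := fun w hw => hw.2
  exact ⟨(hf.subset hsub).image _,
    (ncard_image_le (hf.subset hsub)).trans ((ncard_le_ncard hsub hf).trans hc)⟩

/-- A regular binary operation increases the support of the words by a bounded amount only. -/
theorem exists_boundedValues_of_regularPred {M : ZWord α → ZWord α → ZWord α → Prop}
    {op : ℝ → ℝ → ℝ} {p : ℝ → Prop}
    (hM : RegularPred fun w : ZWord (Option (Option α × Option α) × Option α) =>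
      M ((w.filterMap Prod.fst).filterMap Prod.fst) ((w.filterMap Prod.fst).filterMap Prod.snd)
        (w.filterMap Prod.snd))
    (hex : ∀ x ∈ A, ∀ y ∈ A, p (val x) → p (val y) → ∃ z, M x y z)
    (hop : ∀ x y z, M x y z → z ∈ A ∧ val z = op (val x) (val y)) :
    ∃ C, ∀ r, ∀ a ∈ boundedValues A val r, ∀ b ∈ boundedValues A val r, p a → p b →
      op a b ∈ boundedValues A val (r + C) := by
  obtain ⟨C, hC⟩ := RegularPred.exists_supportedIn
    (P := fun w v => M (w.filterMap Prod.fst) (w.filterMap Prod.snd) v) hM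
  refine ⟨C, ?_⟩
  rintro r _ ⟨x, ⟨hx, hxr⟩, rfl⟩ _ ⟨y, ⟨hy, hyr⟩, rfl⟩ ha hb
  have hs : (x.conv y).SupportedIn r r := fun k hk => by
    by_cases h : x k = none
    · refine hyr k fun h' => hk ?_
      simp [ZWord.conv, h, h']
    · exact hxr k h
  obtain ⟨z, hz, hMz⟩ := hC (x.conv y) r hs (by simpa using hex x hx y hy ha hb)
  rw [filterMap_fst_conv, filterMap_snd_conv] at hMz
  obtain ⟨hzA, hzv⟩ := hop x y z hMz
  exact ⟨z, ⟨hzA, hz⟩, hzv⟩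

/-- With `B = 2 ^ 2 ^ n`, squaring `B` costs one multiplication, and every `m < B ^ 2` is `q * B +
s` with `q, s < B`, one multiplication and one addition: at most `2 * C` per level. -/
theorem natCast_mem_of_growth {S : ℕ → Set ℝ} (hS : Monotone S) {r C : ℕ}
    (h0 : (0 : ℝ) ∈ S r) (h1 : (1 : ℝ) ∈ S r) (h2 : (2 : ℝ) ∈ S r)
    (hadd : ∀ r, ∀ a ∈ S r, ∀ b ∈ S r, a + b ∈ S (r + C))
    (hmul : ∀ r, ∀ a ∈ S r, ∀ b ∈ S r, 0 < a → 0 < b → a * b ∈ S (r + C)) (n : ℕ) :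
    ((2 ^ 2 ^ n : ℕ) : ℝ) ∈ S (r + n * C) ∧ ∀ m : ℕ, m < 2 ^ 2 ^ n → (m : ℝ) ∈ S (r + 2 * n * C) := by
  induction n with
  | zero =>
    refine ⟨by simpa using h2, fun m hm => ?_⟩
    have : m < 2 := by simpa using hm
    interval_cases m
    · simpa using h0
    · simpa using h1
  | succ n ih =>
    obtain ⟨ihp, ihm⟩ := ih
    have hsq : 2 ^ 2 ^ (n + 1) = 2 ^ 2 ^ n * 2 ^ 2 ^ n := by rw [← pow_add]; ring
    have hpos : (0 : ℝ) < ((2 ^ 2 ^ n : ℕ) : ℝ) := by positivity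
    refine ⟨?_, fun m hm => ?_⟩
    · have := hmul _ _ ihp _ ihp hpos hpos
      rw [hsq, Nat.cast_mul]
      exact hS (by ring_nf; rfl) this
    · set B := 2 ^ 2 ^ n with hB
      have hBpos : 0 < B := by positivity
      have hq : m / B < B := Nat.div_lt_of_lt_mul (by rwa [← hsq])
      have hqB : ((m / B * B : ℕ) : ℝ) ∈ S (r + 2 * n * C + C) := by
        -- Only products of positive elements are available, so a zero quotient is treated
        -- separately.
        rcases Nat.eq_zero_or_pos (m / B) with h | h
        · rw [h, zero_mul, Nat.cast_zero]
          exact hS (by nlinarith) h0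
        · rw [Nat.cast_mul]
          exact hmul _ _ (ihm _ hq) _ (hS (by nlinarith) ihp) (by exact_mod_cast h) hpos
      have := hadd _ _ hqB _ (hS (by omega) (ihm _ (Nat.mod_lt m hBpos)))
      rw [← Nat.cast_add, Nat.div_add_mod'] at this
      exact hS (by ring_nf; rfl) this

theorem exists_pow_lt_two_pow_two_pow (k r C : ℕ) :
    ∃ n : ℕ, k ^ (2 * (r + 2 * n * C) + 1) < 2 ^ 2 ^ n := by
  set a := k * (2 * r + 1) with ha
  set b := k * (4 * C) with hb
  -- The exponent of `2` becomes `a + b * (2 * t)` at `n = 2 * t`; this `t` makes it at most `t *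
  -- t`, which is below `2 ^ (2 * t)`.
  set t := a + 2 * b + 1 with ht
  refine ⟨2 * t, ?_⟩
  calc k ^ (2 * (r + 2 * (2 * t) * C) + 1) ≤ (2 ^ k) ^ (2 * (r + 2 * (2 * t) * C) + 1) :=
        Nat.pow_le_pow_left Nat.lt_two_pow_self.le _
    _ = 2 ^ (a + b * (2 * t)) := by rw [← pow_mul]; congr 1; rw [ha, hb]; ring
    _ < 2 ^ 2 ^ (2 * t) := by
        refine Nat.pow_lt_pow_right (by norm_num) ?_
        have h1 : t < 2 ^ t := Nat.lt_two_pow_self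
        have h2 : t * t < 2 ^ (2 * t) := by
          rw [two_mul, pow_add]
          exact Nat.mul_lt_mul'' h1 h1
        have h3 : a + b * (2 * t) ≤ t * t := by nlinarith
        omega

variable {D : Set (ZWord Γ)} {E : ZWord Γ → Set (ℝ × ℝ)}

theorem IsGrid.not_isAutomaticRel_sameArea [Finite α] [Finite Γ] (hA : IsGrid A val)
    (hE : IsAutomaticRectangleFamily A val D E) : ¬ IsAutomaticRel (sameArea D E) := by
  intro hs
  obtain ⟨S, hS⟩ := hA.exists_word
  obtain ⟨o, ho, ho0⟩ := (hS 0).1 S.zero_mem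
  obtain ⟨e, he, he1⟩ := (hS 1).1 S.one_mem
  obtain ⟨t, ht, ht2⟩ := (hS (1 + 1)).1 (S.add_mem S.one_mem S.one_mem)
  obtain ⟨C₁, hC₁⟩ := exists_boundedValues_of_regularPred (A := A) (val := val) (p := fun _ => True)
    (M := fun x y z => (x ∈ A ∧ y ∈ A ∧ z ∈ A) ∧ val x + val y = val z) (op := fun a b => a + b)
    (hA.regularPred_add (by fun_prop) (by fun_prop) (by fun_prop))
    (fun x hx y hy _ _ => by
      obtain ⟨z, hz, h⟩ := (hS _).1 (S.add_mem ((hS _).2 ⟨x, hx, rfl⟩) ((hS _).2 ⟨y, hy, rfl⟩))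
      exact ⟨z, ⟨hx, hy, hz⟩, h.symm⟩)
    (fun x y z h => ⟨h.1.2.2, h.2.symm⟩)
  -- Multiplication of positive elements: `[0,x] × [0,y]` has the area of `[0,1] × [0,z]`.
  -- Positivity keeps the rectangles nondegenerate.
  obtain ⟨C₂, hC₂⟩ := exists_boundedValues_of_regularPred (A := A) (val := val) (p := fun a => 0 < a)
    (M := fun x y z => ∃ d d', IsRectangle A val D E o x o y d ∧ IsRectangle A val D E o e o z d' ∧
      ![d, d'] ∈ sameArea D E) (op := fun a b => a * b)
    (by
      refine RegularPred.exists (RegularPred.exists ?_)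
      refine RegularPred.and ?_ (RegularPred.and ?_ ?_)
      · exact RegularPred.subst_const (P := fun w o => IsRectangle A val D E o _ o _ _) o
          (hA.regularPred_isRectangle hE (by fun_prop) (by fun_prop) (by fun_prop) (by fun_prop)
            (by fun_prop))
      · refine RegularPred.subst_const (P := fun w o => IsRectangle A val D E o _ o _ _) o
          (RegularPred.subst_const (P := fun w e => IsRectangle A val D E _ e _ _ _) e
          (hA.regularPred_isRectangle hE (by fun_prop) (by fun_prop) (by fun_prop) (by fun_prop)
            (by fun_prop)))
      · refine (hs.regularPred (F := ![fun w => (w.filterMap Prod.fst).filterMap Prod.snd,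
          fun w => w.filterMap Prod.snd])
          (Letterwise.matrix_two (by fun_prop) (by fun_prop))).congr fun w => iff_of_eq ?_
        congr 1
        ext i
        fin_cases i <;> rfl)
    (fun x hx y hy hx0 hy0 => by
      obtain ⟨z, hz, h⟩ := (hS _).1 (S.mul_mem ((hS _).2 ⟨x, hx, rfl⟩) ((hS _).2 ⟨y, hy, rfl⟩))
      have hz0 : 0 < val z := by rw [h]; exact mul_pos hx0 hy0
      obtain ⟨d, hd⟩ := hE.exists_index ho hx ho hy (by rwa [ho0]) (by rwa [ho0])
      obtain ⟨d', hd'⟩ := hE.exists_index ho he ho hz (by rw [ho0, he1]; exact one_pos)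
        (by rwa [ho0])
      refine ⟨z, d, d', hd, hd', ?_, ?_⟩
      · simp [Fin.forall_fin_two, hd.index_mem, hd'.index_mem]
      · change volume (E d) = volume (E d')
        rw [hd.volume_eq, hd'.volume_eq, ho0, he1, h]
        simp)
    (fun x y z h => by
      obtain ⟨d, d', hd, hd', -, hv⟩ := h
      refine ⟨hd'.mem_y₂, ?_⟩
      change volume (E d) = volume (E d') at hv
      have h₁ := hd.lt_x
      have h₂ := hd.lt_y
      have h₃ := hd'.lt_y
      rw [hd.volume_eq, hd'.volume_eq, ho0, he1] at hv
      rw [ho0] at h₁ h₂ h₃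
      rw [ENNReal.ofReal_eq_ofReal_iff (by simp; positivity) (by simp; positivity)] at hv
      simpa using hv.symm)
  obtain ⟨r₀, hr₀⟩ := o.exists_supportedIn
  obtain ⟨r₁, hr₁⟩ := e.exists_supportedIn
  obtain ⟨r₂, hr₂⟩ := t.exists_supportedIn
  set r := r₀ + r₁ + r₂ with hr
  have hgrow := natCast_mem_of_growth (S := boundedValues A val) (r := r) (C := C₁ + C₂)
    (fun _ _ h => boundedValues_mono h) ⟨o, ⟨ho, hr₀.mono (by omega) (by omega)⟩, ho0⟩
    ⟨e, ⟨he, hr₁.mono (by omega) (by omega)⟩, he1⟩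
    ⟨t, ⟨ht, hr₂.mono (by omega) (by omega)⟩, ht2.trans (by norm_num)⟩
    (fun s a ha b hb => boundedValues_mono (by omega) (hC₁ s a ha b hb trivial trivial))
    (fun s a ha b hb ha0 hb0 => boundedValues_mono (by omega) (hC₂ s a ha b hb ha0 hb0))
  obtain ⟨n, hn⟩ := exists_pow_lt_two_pow_two_pow (Nat.card (Option α)) r (C₁ + C₂)
  obtain ⟨hfin, hcard⟩ := ncard_boundedValues_le (A := A) (val := val) (r + 2 * n * (C₁ + C₂))
  -- Counting: `2 ^ 2 ^ n` distinct values would come from fewer words.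
  have hsub : (fun m : ℕ => (m : ℝ)) '' (Finset.range (2 ^ 2 ^ n) : Set ℕ) ⊆
      boundedValues A val (r + 2 * n * (C₁ + C₂)) := by
    rintro _ ⟨m, hm, rfl⟩
    exact (hgrow n).2 m (by simpa using hm)
  have := ncard_le_ncard hsub hfin
  rw [ncard_image_of_injective _ Nat.cast_injective, ncard_coe_finset, Finset.card_range] at this
  omega

end Growth

/-! ### Interleaved positions and carries -/

/-- The position of an interleaved numeral that belongs to the exponent `j`. -/
def interleavedPosition (j : ℤ) : ℕ := if 0 < j then (2 * j - 1).toNat else (-2 * j).toNat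

theorem interleavedPosition_interleavedExponent (k : ℕ) :
    interleavedPosition (interleavedExponent k) = k := by
  unfold interleavedPosition interleavedExponent
  split_ifs <;> omega

theorem interleavedExponent_interleavedPosition (j : ℤ) :
    interleavedExponent (interleavedPosition j) = j := by
  unfold interleavedPosition interleavedExponent
  split_ifs <;> omega

/-- Positions of interleaved numerals correspond to exponents. -/
def interleavedEquiv : ℕ ≃ ℤ where
  toFun := interleavedExponent
  invFun := interleavedPosition
  left_inv := interleavedPosition_interleavedExponent
  right_inv := interleavedExponent_interleavedPosition

theorem finsum_interleavedExponent (g : ℕ → ℝ) (b : ℝ) :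
    ∑ᶠ k : ℕ, g k * b ^ interleavedExponent k =
      ∑ᶠ j : ℤ, g (interleavedPosition j) * b ^ j := by
  rw [← finsum_comp_equiv interleavedEquiv]
  refine finsum_congr fun k => ?_
  simp [interleavedEquiv, interleavedPosition_interleavedExponent]

theorem ZWord.finite_support_comp {M : Type} [Zero M] (w : ZWord X) {ψ : Option X → M}
    (hψ : ψ none = 0) (e : β → ℤ) (he : Function.Injective e) :
    (Function.support fun i => ψ (w (e i))).Finite := by
  refine (w.finite_dom.preimage he.injOn).subset fun i hi => ?_
  simp only [Function.mem_support, mem_preimage, mem_ofPred_eq] at hi ⊢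
  intro h
  rw [h] at hi
  exact hi hψ

theorem interleavedPosition_injective : Function.Injective fun j => (interleavedPosition j : ℤ) :=
  Nat.cast_injective.comp interleavedEquiv.symm.injective

/-- Division from the lowest digit upwards: `b` divides `c₀ + f 0`, and the quotient is the next
carry. Its absolute value is at most `2 * B / b ≤ B`. -/
theorem exists_carries_nat {b : ℤ} (hb : 2 ≤ b) (B : ℤ) (M : ℕ) (f : ℕ → ℤ) (hf : ∀ i, |f i| ≤ B)
    (c₀ : ℤ) (hc₀ : |c₀| ≤ B) (h : c₀ + ∑ i ∈ Finset.range M, f i * b ^ i = 0) :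
    ∃ c : ℕ → ℤ, c 0 = c₀ ∧ (∀ i < M, f i + c i = b * c (i + 1)) ∧ (∀ i, M ≤ i → c i = 0) ∧
      ∀ i, |c i| ≤ B := by
  induction M generalizing f c₀ with
  | zero =>
    refine ⟨fun _ => 0, by simpa using h.symm, by simp, by simp, fun i => ?_⟩
    simpa using (abs_nonneg _).trans hc₀
  | succ M ih =>
    rw [Finset.sum_range_succ'] at h
    have h' : c₀ + f 0 + b * ∑ i ∈ Finset.range M, f (i + 1) * b ^ i = 0 := by
      rw [← h, Finset.mul_sum]
      simp only [pow_succ, pow_zero]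
      rw [add_assoc, add_comm (f 0)]
      congr 2
      · exact Finset.sum_congr rfl fun i _ => by ring
      · ring
    obtain ⟨c₁, hc₁⟩ : b ∣ c₀ + f 0 :=
      ⟨-∑ i ∈ Finset.range M, f (i + 1) * b ^ i, by linarith⟩
    have hb0 : (0 : ℤ) < b := by linarith
    have hB : 0 ≤ B := (abs_nonneg _).trans hc₀
    have hc₁B : |c₁| ≤ B := by
      have h0 := hf 0
      rw [abs_le] at h0 hc₀ ⊢
      constructor <;> by_contra hlt <;> push Not at hlt <;> nlinarith
    have hsum : c₁ + ∑ i ∈ Finset.range M, f (i + 1) * b ^ i = 0 := by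
      rw [hc₁, ← mul_add] at h'
      exact (mul_eq_zero.1 h').resolve_left hb0.ne'
    obtain ⟨c, hc0, hc, hcM, hcB⟩ := ih (fun i => f (i + 1)) (fun i => hf _) c₁ hc₁B hsum
    refine ⟨fun i => Nat.casesOn i c₀ c, rfl, fun i hi => ?_, fun i hi => ?_, fun i => ?_⟩
    · cases i with
      | zero => simp only [hc0]; rw [add_comm]; exact hc₁
      | succ i => exact hc i (by omega)
    · cases i with
      | zero => omega
      | succ i => exact hcM i (by omega)
    · cases i with
      | zero => exact hc₀
      | succ i => exact hcB i

/-- A finite sum of multiples of powers of `b` vanishes if and only if there are bounded carries. -/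
theorem finsum_zpow_eq_zero_iff {b : ℕ} (hb : 2 ≤ b) (B : ℤ) (e : ℤ → ℤ)
    (he : (Function.support e).Finite) (hB : ∀ j, |e j| ≤ B) :
    ∑ᶠ j : ℤ, (e j : ℝ) * (b : ℝ) ^ j = 0 ↔
      ∃ c : ℤ → ℤ, (Function.support c).Finite ∧ (∀ j, |c j| ≤ B) ∧
        ∀ j, e j + c j = b * c (j + 1) := by
  have hb0 : (b : ℝ) ≠ 0 := by
    have : b ≠ 0 := by omega
    exact_mod_cast this
  constructor
  · intro h
    obtain ⟨N₁, hN₁⟩ := he.bddBelow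
    obtain ⟨N₂, hN₂⟩ := he.bddAbove
    set N := N₁.natAbs + N₂.natAbs with hN
    have hout : ∀ j, (j < -(N : ℤ) ∨ (N : ℤ) < j) → e j = 0 := fun j hj => by
      by_contra hne
      have h₁ := hN₁ (show j ∈ Function.support e from hne)
      have h₂ := hN₂ (show j ∈ Function.support e from hne)
      omega
    have hinj : Function.Injective fun i : ℕ => (i : ℤ) - N := fun i j hij => by
      simpa using hij
    rw [finsum_eq_sum_of_support_subset (s := (Finset.range (2 * N + 1)).image fun i : ℕ => (i : ℤ) - N)
      _ fun j hj => ?_, Finset.sum_image fun i _ j _ hij => hinj hij] at h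
    -- Multiplication by `b ^ N` clears the negative exponents.
    · have hz : (0 : ℤ) + ∑ i ∈ Finset.range (2 * N + 1), e ((i : ℤ) - N) * (b : ℤ) ^ i = 0 := by
        have : ((∑ i ∈ Finset.range (2 * N + 1), e ((i : ℤ) - N) * (b : ℤ) ^ i : ℤ) : ℝ) =
            (b : ℝ) ^ (N : ℤ) *
              ∑ i ∈ Finset.range (2 * N + 1), (e ((i : ℤ) - N) : ℝ) * (b : ℝ) ^ ((i : ℤ) - N) := by
          rw [Finset.mul_sum]
          push_cast
          refine Finset.sum_congr rfl fun i _ => ?_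
          rw [mul_left_comm, ← zpow_add₀ hb0]
          simp
        rw [h, mul_zero] at this
        rw [zero_add]
        exact_mod_cast this
      obtain ⟨c, hc0, hc, hcM, hcB⟩ := exists_carries_nat (by exact_mod_cast hb) B _ _
        (fun i => hB _) 0 (by simpa using (abs_nonneg _).trans (hB 0)) hz
      refine ⟨fun j => c (j + N).toNat, ?_, fun j => hcB _, fun j => ?_⟩
      · refine (Set.finite_Icc (-(N : ℤ)) (N + 1)).subset fun j hj => ?_
        by_contra hne
        apply hj
        by_cases hlt : j < -(N : ℤ)
        · simp only [show (j + N).toNat = 0 by omega, hc0]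
        · rw [mem_Icc] at hne
          exact hcM _ (by omega)
      · by_cases hlt : j < -(N : ℤ)
        · simp only [show (j + N).toNat = 0 by omega, show (j + 1 + N).toNat = 0 by omega, hc0,
            hout j (Or.inl hlt)]
          simp
        · by_cases hgt : (N : ℤ) < j
          · simp only [hcM (j + N).toNat (by omega), hcM (j + 1 + N).toNat (by omega),
              hout j (Or.inr hgt)]
            simp
          · have := hc (j + N).toNat (by omega)
            rw [show (((j + N).toNat : ℕ) : ℤ) - N = j by omega] at this
            beta_reduce
            rw [this, show (j + 1 + N).toNat = (j + N).toNat + 1 by omega]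
    · simp only [Finset.coe_image, Finset.coe_range, mem_image, mem_Iio]
      have hne : e j ≠ 0 := fun h0 => hj (by simp [h0])
      refine ⟨(j + N).toNat, ?_, ?_⟩ <;>
      · by_contra hcon
        exact hne (hout j (by omega))
  · rintro ⟨c, hc, -, hcarry⟩
    have hcr : (Function.support fun j => (c j : ℝ) * (b : ℝ) ^ j).Finite :=
      hc.subset fun j hj h0 => hj (by simp [h0])
    have hshift := finsum_comp_equiv (Equiv.addRight (1 : ℤ)) (f := fun j => (c j : ℝ) * (b : ℝ) ^ j)
    simp only [Equiv.coe_addRight] at hshift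
    have hcr' : (Function.support fun j => (c (j + 1) : ℝ) * (b : ℝ) ^ (j + 1)).Finite :=
      hcr.preimage (f := fun j => j + 1) (add_left_injective (1 : ℤ)).injOn
    -- By the carry equation each term is a difference of consecutive terms `c j * b ^ j`, so the
    -- sum telescopes.
    have : ∀ j, (e j : ℝ) * (b : ℝ) ^ j =
        (c (j + 1) : ℝ) * (b : ℝ) ^ (j + 1) - (c j : ℝ) * (b : ℝ) ^ j := fun j => by
      have h : (e j : ℝ) = b * c (j + 1) - c j := by
        rw [eq_sub_iff_add_eq]
        exact_mod_cast hcarry j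
      rw [h, zpow_add_one₀ hb0]
      ring
    rw [finsum_congr this, finsum_sub_distrib hcr' hcr, hshift, sub_self]

/-- A condition on three consecutive symbols is regular. -/
theorem regularPred_local_three [Finite X]
    (φ : Bool × Bool × Bool → Option X → Option X → Option X → Prop)
    (hφ : ∀ c, φ c none none none) :
    RegularPred fun w : ZWord X => ∀ k : ℤ, φ (posClass k) (w k) (w (k + 1)) (w (k + 2)) := by
  -- The second component is a guessed copy of the word shifted by one, so its value at the next
  -- position is the symbol two places ahead.
  have h := regularPred_local (X := Option X × Option X)
    (fun q q' => q.2.bind Prod.snd = q'.2.bind Prod.fst ∧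
      φ q.1 (q.2.bind Prod.fst) (q'.2.bind Prod.fst) (q'.2.bind Prod.snd)) (by simpa using hφ)
  refine (RegularPred.exists (P := fun w v => ∀ k, v k = w (k + 1) ∧
    φ (posClass k) (w k) (w (k + 1)) (v (k + 1))) h).congr fun w => ?_
  constructor
  · intro h
    refine ⟨w.shift 1, fun k => ⟨rfl, ?_⟩⟩
    have := h k
    rwa [show k + 2 = k + 1 + 1 by ring] at this
  · rintro ⟨v, hv⟩ k
    rw [show k + 2 = k + 1 + 1 by ring, ← (hv (k + 1)).1]
    exact (hv k).2

namespace ZWord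

/-- The word with the symbol `g j` at the position of the exponent `j`. -/
def ofExponents (g : ℤ → Option α) (hg : {j | g j ≠ none}.Finite) : ZWord α where
  toFun k := if 0 ≤ k then g (interleavedExponent k.toNat) else none
  finite_dom := by
    refine (hg.image fun j => (interleavedPosition j : ℤ)).subset fun k hk => ?_
    simp only [mem_ofPred_eq, ne_eq, ite_eq_right_iff, not_forall] at hk
    obtain ⟨h0, hk⟩ := hk
    exact ⟨_, hk, by simp [interleavedPosition_interleavedExponent, h0]⟩

theorem ofExponents_interleavedPosition (g : ℤ → Option α) (hg : {j | g j ≠ none}.Finite) (j : ℤ) :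
    ofExponents g hg (interleavedPosition j) = g j := by
  simp [ofExponents, interleavedExponent_interleavedPosition]

end ZWord

/-- A relation between the symbols that belong to adjacent exponents, in terms of positions. -/
theorem forall_interleavedPosition_iff (R : ℤ → ℤ → Prop) :
    (∀ j : ℤ, R (interleavedPosition j) (interleavedPosition (j + 1))) ↔
      ∀ k : ℤ, ((posClass k).2.2 = true → R k (k + 1)) ∧
        (((posClass k).1 = true ∧ (posClass k).2.1 = false) → R k (k + 2)) ∧
        ((posClass k).2.1 = true → R (k + 2) k) := by
  -- The exponent after that of position `0` is at `1`; on odd positions exponents rise by one every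
  -- two places, on even ones they fall.
  simp only [posClass, decide_eq_true_eq, decide_eq_false_iff_not]
  constructor
  · refine fun h k => ⟨?_, ?_, ?_⟩
    · rintro rfl
      exact h 0
    · rintro ⟨h₁, h₂⟩
      have := h ((k + 1) / 2)
      simp only [interleavedPosition] at this
      rw [if_pos (by omega), if_pos (by omega)] at this
      convert this using 1 <;> omega
    · rintro ⟨h₁, h₂⟩
      have := h (-((k + 2) / 2))
      simp only [interleavedPosition] at this
      rw [if_neg (by omega), if_neg (by omega)] at this
      convert this using 1 <;> omega
  · intro h j
    rcases lt_trichotomy j 0 with hj | rfl | hj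
    · have := (h (-2 * j - 2)).2.2 (by omega)
      simp only [interleavedPosition]
      rw [if_neg (by omega), if_neg (by omega)]
      convert this using 1 <;> omega
    · exact (h 0).1 rfl
    · have := (h (2 * j - 1)).2.1 (by omega)
      simp only [interleavedPosition]
      rw [if_pos (by omega), if_pos (by omega)]
      convert this using 1 <;> omega

/-- The carries are guessed as a word over the finite alphabet `[-B, B]`, each at the position of
its exponent. The carry equation then involves positions at distance at most two. -/
theorem regularPred_finsum_eq_zero [Finite X] {b : ℕ} (hb : 2 ≤ b) (ψ : Option X → ℤ)
    (hψ : ψ none = 0) :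
    RegularPred fun w : ZWord X =>
      ∑ᶠ k : ℕ, (ψ (w k) : ℝ) * (b : ℝ) ^ interleavedExponent k = 0 := by
  obtain ⟨B, hB⟩ : ∃ B : ℤ, ∀ o, |ψ o| ≤ B := by
    obtain ⟨B, hB⟩ := (toFinite (range fun o => |ψ o|)).bddAbove
    exact ⟨B, fun o => hB ⟨o, rfl⟩⟩
  have : Finite (Icc (-B) B) := (Set.finite_Icc _ _).to_subtype
  let ξ : Option (Icc (-B) B) → ℤ := fun o => o.elim 0 fun c => c.1
  have hξ : ∀ o, |ξ o| ≤ B := by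
    rintro (_ | c)
    · simpa [ξ, hψ] using hB none
    · exact abs_le.2 c.2
  let R : Option (Option X × Option (Icc (-B) B)) → Option (Option X × Option (Icc (-B) B)) → Prop :=
    fun a a' => ψ (a.bind Prod.fst) + ξ (a.bind Prod.snd) = b * ξ (a'.bind Prod.snd)
  have hloc := regularPred_local_three (X := Option X × Option (Icc (-B) B))
    (fun c a₀ a₁ a₂ => (c.2.2 = true → R a₀ a₁) ∧
      ((c.1 = true ∧ c.2.1 = false) → R a₀ a₂) ∧ (c.2.1 = true → R a₂ a₀)) (by simp [R, ξ, hψ])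
  refine (RegularPred.exists (P := fun (w : ZWord X) (v : ZWord (Icc (-B) B)) => ∀ j : ℤ,
    ψ (w (interleavedPosition j)) + ξ (v (interleavedPosition j)) =
      b * ξ (v (interleavedPosition (j + 1)))) (hloc.congr fun u => ?_)).congr fun w => ?_
  · exact forall_interleavedPosition_iff fun k k' => R (u k) (u k')
  · rw [finsum_interleavedExponent (fun k => (ψ (w k) : ℝ)), finsum_zpow_eq_zero_iff hb B
      (fun j => ψ (w (interleavedPosition j)))
      (w.finite_support_comp hψ _ interleavedPosition_injective) (fun j => hB _)]
    constructor
    · rintro ⟨c, hc, hcB, h⟩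
      -- A zero carry is written as a blank, which keeps the domain finite.
      have hfin : {j | (if c j = 0 then none else
          some (⟨c j, abs_le.1 (hcB j)⟩ : Icc (-B) B)) ≠ none}.Finite :=
        hc.subset fun j hj h0 => by simp [h0] at hj
      have hv : ∀ j, ξ (if c j = 0 then none else
          some (⟨c j, abs_le.1 (hcB j)⟩ : Icc (-B) B)) = c j := fun j => by
        split_ifs with h0
        · exact h0.symm
        · rfl
      refine ⟨ofExponents _ hfin, fun j => ?_⟩
      rw [ofExponents_interleavedPosition, ofExponents_interleavedPosition, hv, hv]
      exact h j
    · rintro ⟨v, hv⟩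
      exact ⟨fun j => ξ (v (interleavedPosition j)),
        v.finite_support_comp rfl _ interleavedPosition_injective, fun j => hξ _, hv⟩

/-! ### Linear equations between numerals -/

variable {b : ℕ}

/-- The absolute value of the number that an interleaved numeral represents. -/
def interleavedAbs (b : ℕ) (w : ZWord (SignedDigit b)) : ℝ :=
  ∑ᶠ k : ℕ, digitValue (w (k : ℤ)) * (b : ℝ) ^ interleavedExponent k

theorem interleavedValue_eq (w : ZWord (SignedDigit b)) :
    interleavedValue b w = (if w (-1) = some (Sum.inr ()) then -1 else 1) * interleavedAbs b w := by
  unfold interleavedValue interleavedAbs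
  congr

/-- The numerical value of a digit as an integer. -/
def digitInt {b : ℕ} : Option (SignedDigit b) → ℤ
  | some (Sum.inl a) => ((a : ℕ) : ℤ)
  | _ => 0

theorem digitValue_eq (o : Option (SignedDigit b)) : digitValue o = (digitInt o : ℝ) := by
  rcases o with _ | _ | _ <;> simp [digitValue, digitInt]

theorem digitValue_nonneg (o : Option (SignedDigit b)) : 0 ≤ digitValue o := by
  rcases o with _ | _ | _ <;> simp [digitValue]

theorem interleavedAbs_nonneg (w : ZWord (SignedDigit b)) : 0 ≤ interleavedAbs b w :=
  finsum_nonneg fun k => mul_nonneg (digitValue_nonneg _) (by positivity)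

/-- The combination is a single expansion whose digits are `∑ a i * digit`, taken from a finite set
of integers. -/
theorem regularPred_linear_abs [Finite X] (hb : 2 ≤ b) {ι : Type} [Fintype ι] (a : ι → ℤ)
    {F : ι → ZWord X → ZWord (SignedDigit b)} (hF : ∀ i, Letterwise (F i)) :
    RegularPred fun w => ∑ i, (a i : ℝ) * interleavedAbs b (F i w) = 0 := by
  choose f hf using hF
  refine (regularPred_finsum_eq_zero hb (fun o : Option X => ∑ i, a i * digitInt (o.bind (f i)))
    (by simp [digitInt])).congr fun w => ?_
  have hfin : ∀ i, (Function.support fun k : ℕ => (a i : ℝ) *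
      (digitValue (F i w (k : ℤ)) * (b : ℝ) ^ interleavedExponent k)).Finite := fun i =>
    ((F i w).finite_support_comp (ψ := digitValue) rfl _ Nat.cast_injective).subset
      fun k hk h0 => hk (by simp [h0])
  have : ∀ i, (a i : ℝ) * interleavedAbs b (F i w) = ∑ᶠ k : ℕ, (a i : ℝ) *
      (digitValue (F i w (k : ℤ)) * (b : ℝ) ^ interleavedExponent k) := fun i => by
    rw [interleavedAbs]
    simpa using smul_finsum (a i : ℝ)
      fun k : ℕ => digitValue (F i w (k : ℤ)) * (b : ℝ) ^ interleavedExponent k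
  simp only [this]
  rw [← finsum_sum_comm _ _ fun i _ => hfin i]
  refine iff_of_eq (congrArg (· = 0) (finsum_congr fun k => ?_))
  push_cast
  rw [Finset.sum_mul]
  refine Finset.sum_congr rfl fun i _ => ?_
  rw [hf, filterMap_apply, digitValue_eq]
  ring

/-- There are finitely many sign patterns `σ`; for each, the signs are absorbed into the
coefficients. -/
theorem regularPred_linear [Finite X] (hb : 2 ≤ b) {ι : Type} [Fintype ι] (a : ι → ℤ)
    {F : ι → ZWord X → ZWord (SignedDigit b)} (hF : ∀ i, Letterwise (F i)) :
    RegularPred fun w => ∑ i, (a i : ℝ) * interleavedValue b (F i w) = 0 := by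
  classical
  have hsign : ∀ (i : ι) (s : Bool),
      RegularPred fun w => (decide (F i w (-1) = some (Sum.inr ()))) = s := fun i s =>
    (regularPred_apply (X := SignedDigit b) (fun o => decide (o = some (Sum.inr ())) = s) (-1)).comp
      (hF i)
  refine (RegularPred.exists_fintype (ι := ι → Bool) fun σ =>
    (RegularPred.exists_finset Finset.univ fun i _ => (hsign i (σ i)).not).not.and
    (regularPred_linear_abs hb (fun i => (if σ i then -1 else 1) * a i) hF)).congr fun w => ?_
  constructor
  · intro h
    refine ⟨fun i => decide (F i w (-1) = some (Sum.inr ())), by simp, ?_⟩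
    rw [← h]
    refine Finset.sum_congr rfl fun i _ => ?_
    rw [interleavedValue_eq]
    simp only [decide_eq_true_eq]
    split_ifs <;> push_cast <;> ring
  · rintro ⟨σ, hσ, h⟩
    rw [← h]
    refine Finset.sum_congr rfl fun i _ => ?_
    have hi : decide (F i w (-1) = some (Sum.inr ())) = σ i := by
      by_contra hne
      exact hσ ⟨i, Finset.mem_univ i, hne⟩
    rw [interleavedValue_eq, ← hi]
    simp only [decide_eq_true_eq]
    split_ifs <;> push_cast <;> ring

/-! ### The numerals as a grid -/

theorem isRegularSet_interleavedWords : IsRegularSet (interleavedWords b) := by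
  have h₁ := regularPred_apply (X := SignedDigit b)
    (fun o => o = none ∨ o = some (Sum.inr ())) (-1)
  have h₂ := regularPred_apply (X := SignedDigit b) (fun o => ∃ a, o = some (Sum.inl a)) 0
  -- The class of the next position serves to express `k < -1` as `k + 1 < 0`; on nonnegative
  -- positions a blank must be followed by a blank.
  have h₃ := regularPred_local (X := SignedDigit b) (fun q q' =>
    (q'.1.1 = false → q.2 = none) ∧ (q.1.1 = true → (q.2 = none ∨ ∃ a, q.2 = some (Sum.inl a)) ∧
      (q.2 = none → q'.2 = none))) (by simp)
  refine ((h₁.and h₂).and h₃).congr fun w => ?_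
  simp only [posClass, decide_eq_true_eq, decide_eq_false_iff_not]
  constructor
  · rintro ⟨h₁, h₂, N, hN⟩
    refine ⟨⟨h₁, (hN 0).1 (Nat.zero_le _)⟩, fun k => ⟨fun hk => h₂ k (by omega), fun hk => ?_⟩⟩
    lift k to ℕ using hk
    by_cases hkN : k ≤ N
    · obtain ⟨a, ha⟩ := (hN k).1 hkN
      exact ⟨Or.inr ⟨a, ha⟩, fun h0 => by simp [h0] at ha⟩
    · exact ⟨Or.inl ((hN k).2 (by omega)), fun _ => by
        exact_mod_cast (hN (k + 1)).2 (by omega)⟩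
  · rintro ⟨⟨h₁, a, ha⟩, h⟩
    refine ⟨h₁, fun k hk => (h k).1 (by omega), ?_⟩
    obtain ⟨M, hM⟩ := w.exists_supportedIn
    have hex : ∃ n : ℕ, w (n : ℤ) = none :=
      ⟨M + 1, by_contra fun hne => by have := hM _ hne; omega⟩
    classical
    have hpos : Nat.find hex ≠ 0 := fun h0 => by
      have := Nat.find_spec hex
      rw [h0, Nat.cast_zero, ha] at this
      exact absurd this (by simp)
    refine ⟨Nat.find hex - 1, fun k => ⟨fun hk => ?_, fun hk => ?_⟩⟩
    · exact (((h k).2 (by omega)).1).resolve_left (Nat.find_min hex (by omega))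
    · obtain ⟨d, rfl⟩ : ∃ d, k = Nat.find hex + d := ⟨k - Nat.find hex, by omega⟩
      clear hk
      induction d with
      | zero => exact Nat.find_spec hex
      | succ d ih => exact_mod_cast ((h _).2 (by omega)).2 ih

theorem mem_adicRationals_iff (hb : 2 ≤ b) {x : ℝ} :
    x ∈ adicRationals b ↔ ∃ (n : ℤ) (m : ℕ), x = (n : ℝ) / (b : ℝ) ^ m := by
  have hb0 : (b : ℝ) ≠ 0 := by
    have : b ≠ 0 := by omega
    exact_mod_cast this
  constructor
  · rintro ⟨n, m, rfl⟩
    obtain ⟨m, rfl | rfl⟩ := m.eq_nat_or_neg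
    · exact ⟨n, m, by simp⟩
    · exact ⟨n * b ^ m, 0, by simp⟩
  · rintro ⟨n, m, rfl⟩
    exact ⟨n, m, by simp⟩

/-- The ring of the rational numbers with a finite expansion in base `b`. -/
def adicSubring (hb : 2 ≤ b) : Subring ℝ where
  carrier := adicRationals b
  zero_mem' := ⟨0, 0, by simp⟩
  one_mem' := ⟨1, 0, by simp⟩
  add_mem' := by
    intro x y hx hy
    rw [mem_adicRationals_iff hb] at hx hy ⊢
    obtain ⟨n, m, rfl⟩ := hx
    obtain ⟨n', m', rfl⟩ := hy
    have hb0 : (b : ℝ) ≠ 0 := by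
      have : b ≠ 0 := by omega
      exact_mod_cast this
    refine ⟨n * b ^ m' + n' * b ^ m, m + m', ?_⟩
    push_cast
    rw [div_add_div _ _ (pow_ne_zero _ hb0) (pow_ne_zero _ hb0), pow_add]
    ring
  mul_mem' := by
    rintro _ _ ⟨n, m, rfl⟩ ⟨n', m', rfl⟩
    have hb0 : (b : ℝ) ≠ 0 := by
      have : b ≠ 0 := by omega
      exact_mod_cast this
    refine ⟨n * n', m + m', ?_⟩
    rw [zpow_add₀ hb0, div_mul_div_comm]
    push_cast
    rfl
  neg_mem' := by
    rintro _ ⟨n, m, rfl⟩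
    exact ⟨-n, m, by push_cast; ring⟩

theorem mem_adicSubring (hb : 2 ≤ b) {x : ℝ} : x ∈ adicSubring hb ↔ x ∈ adicRationals b := Iff.rfl

theorem zpow_mem_adicSubring (hb : 2 ≤ b) (j : ℤ) : (b : ℝ) ^ j ∈ adicSubring hb :=
  ⟨1, -j, by simp⟩

theorem dense_adicRationals (hb : 2 ≤ b) : Dense (adicRationals b) := by
  refine (adicSubring hb).toAddSubgroup.dense_of_not_isolated_zero fun ε hε => ?_
  have hb1 : (1 : ℝ) < b := by exact_mod_cast hb
  obtain ⟨n, hn⟩ := exists_pow_lt_of_lt_one hε (inv_lt_one_of_one_lt₀ hb1)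
  refine ⟨(b : ℝ) ^ (-(n : ℤ)), zpow_mem_adicSubring hb _, by positivity, ?_⟩
  rwa [zpow_neg, zpow_natCast, ← inv_pow]

theorem interleavedValue_mem (hb : 2 ≤ b) (w : ZWord (SignedDigit b)) :
    interleavedValue b w ∈ adicRationals b := by
  rw [interleavedValue_eq, ← mem_adicSubring hb]
  refine (adicSubring hb).mul_mem ?_ ?_
  · split_ifs
    · exact (adicSubring hb).neg_mem (adicSubring hb).one_mem
    · exact (adicSubring hb).one_mem
  · refine finsum_induction (· ∈ adicSubring hb) (adicSubring hb).zero_mem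
      (fun _ _ => (adicSubring hb).add_mem) fun k =>
      (adicSubring hb).mul_mem ?_ (zpow_mem_adicSubring hb _)
    rw [digitValue_eq]
    exact intCast_mem _ _

/-- The lowest digit `n % b` is placed at the exponent `j`, and `n / b` is expanded from `j + 1` on.
-/
theorem exists_digits (hb : 2 ≤ b) (n : ℕ) (j : ℤ) :
    ∃ d : ℤ → ℕ, (∀ i, d i < b) ∧ (Function.support d).Finite ∧ (∀ i < j, d i = 0) ∧
      ∑ᶠ i : ℤ, (d i : ℝ) * (b : ℝ) ^ i = n * (b : ℝ) ^ j := by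
  have hb0 : (b : ℝ) ≠ 0 := by
    have : b ≠ 0 := by omega
    exact_mod_cast this
  induction n using Nat.strong_induction_on generalizing j with
  | _ n ih =>
    rcases Nat.eq_zero_or_pos n with rfl | hn
    · exact ⟨fun _ => 0, fun _ => by simp only; omega, by simp, fun _ _ => rfl, by simp⟩
    · obtain ⟨d, hd, hfin, hj, hsum⟩ := ih (n / b) (Nat.div_lt_self hn (by omega)) (j + 1)
      refine ⟨fun i => if i = j then n % b else d i, fun i => ?_, ?_, fun i hi => ?_, ?_⟩
      · beta_reduce
        split_ifs
        exacts [Nat.mod_lt _ (by omega), hd i]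
      · refine (hfin.insert j).subset fun i hi => ?_
        by_cases hij : i = j
        · exact Or.inl hij
        · exact Or.inr (by simpa [hij] using hi)
      · beta_reduce
        rw [if_neg hi.ne]
        exact hj i (by omega)
      · have hsplit : ∀ i, (((if i = j then n % b else d i : ℕ) : ℝ)) * (b : ℝ) ^ i =
            (if i = j then ((n % b : ℕ) : ℝ) * (b : ℝ) ^ j else 0) + (d i : ℝ) * (b : ℝ) ^ i := by
          intro i
          by_cases hij : i = j
          · subst hij
            simp [hj i (by omega)]
          · simp [hij]
        rw [finsum_congr hsplit, finsum_add_distrib, hsum, finsum_eq_single _ j fun i hi => if_neg hi,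
          if_pos rfl, zpow_add_one₀ hb0]
        · have : ((n % b : ℕ) : ℝ) + b * ((n / b : ℕ) : ℝ) = n := by
            exact_mod_cast Nat.mod_add_div n b
          rw [← this]
          ring
        · exact (finite_singleton j).subset fun i hi => by
            by_contra hne
            exact hi (if_neg hne)
        · exact hfin.subset fun i hi h0 => hi (by simp [h0])

/-- The interleaved numeral with the given sign and digits, of the length `N + 1`. -/
def numeral (s : Prop) [Decidable s] (N : ℕ) (d : ℤ → Fin b) : ZWord (SignedDigit b) where
  toFun k := if k = -1 ∧ s then some (Sum.inr ()) else
    if 0 ≤ k ∧ k ≤ N then some (Sum.inl (d (interleavedExponent k.toNat))) else none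
  finite_dom := (Set.finite_Icc (-1 : ℤ) N).subset fun k hk => by
    simp only [mem_ofPred_eq] at hk
    split_ifs at hk with h₁ h₂
    · exact ⟨by omega, by omega⟩
    · exact ⟨by omega, h₂.2⟩
    · exact absurd rfl hk

theorem numeral_mem (s : Prop) [Decidable s] (N : ℕ) (d : ℤ → Fin b) :
    numeral s N d ∈ interleavedWords b := by
  refine ⟨?_, fun k hk => ?_, N, fun k => ⟨fun hk => ?_, fun hk => ?_⟩⟩
  · by_cases hs : s <;> simp [numeral, hs]
  · simp only [numeral]
    rw [if_neg (by omega), if_neg (by omega)]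
  · simp only [numeral]
    rw [if_neg (by omega), if_pos (by omega)]
    exact ⟨_, rfl⟩
  · simp only [numeral]
    rw [if_neg (by omega), if_neg (by omega)]

theorem image_interleavedWords (hb : 2 ≤ b) :
    interleavedValue b '' interleavedWords b = adicRationals b := by
  classical
  ext x
  refine ⟨fun ⟨w, _, hw⟩ => hw ▸ interleavedValue_mem hb w, ?_⟩
  rintro ⟨n, m, rfl⟩
  obtain ⟨d, hd, hfin, -, hsum⟩ := exists_digits hb n.natAbs (-m)
  -- All nonzero digits stand at positions up to `N`; shorter expansions are filled up with zeros.
  obtain ⟨N, hN⟩ := (hfin.image interleavedPosition).bddAbove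
  refine ⟨numeral (n < 0) N fun j => ⟨d j, hd j⟩, numeral_mem _ _ _, ?_⟩
  have habs : interleavedAbs b (numeral (n < 0) N fun j => ⟨d j, hd j⟩) =
      n.natAbs * (b : ℝ) ^ (-m) := by
    rw [← hsum, interleavedAbs, finsum_interleavedExponent]
    refine finsum_congr fun j => ?_
    congr 1
    simp only [numeral]
    rw [if_neg (by omega)]
    split_ifs with h
    · simp [digitValue, interleavedExponent_interleavedPosition]
    · have : d j = 0 := by
        by_contra hne
        have := hN ⟨j, hne, rfl⟩
        omega
      simp [digitValue, this]
  have hsign : numeral (n < 0) N (fun j => ⟨d j, hd j⟩) (-1) = some (Sum.inr ()) ↔ n < 0 := by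
    simp [numeral]
  rw [interleavedValue_eq, habs, zpow_neg, div_eq_mul_inv, ← mul_assoc]
  congr 1
  have hcast : ((n.natAbs : ℕ) : ℝ) = |(n : ℝ)| := by
    rw [← Int.cast_abs, Int.abs_eq_natAbs]
    simp
  rw [hcast]
  split_ifs with h
  · rw [abs_of_neg (by exact_mod_cast hsign.1 h)]
    ring
  · rw [abs_of_nonneg, one_mul]
    exact_mod_cast not_lt.1 fun h' => h (hsign.2 h')

theorem isGrid_interleaved (hb : 2 ≤ b) {A : Set (ZWord (SignedDigit b))} (hA : IsRegularSet A)
    (hval : interleavedValue b '' A = adicRationals b) : IsGrid A (interleavedValue b) := by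
  have hmem : ∀ h, RegularPred fun w : ZWord (Fin h → Option (SignedDigit b)) =>
      ∀ i, (w.filterMap fun a => a i) ∈ A := fun h =>
    RegularPred.forall_fin fun i => hA.regularPred.filterMap _
  refine ⟨hA, ⟨adicSubring hb, hval, dense_adicRationals hb⟩, ?_, ?_, ?_, fun c hc => ?_⟩
  · refine isAutomaticRel_of_regularPred ((hmem 3).and ((regularPred_linear hb ![1, 1, -1]
      (F := fun i w => w.filterMap fun a => a i) fun i => letterwise_filterMap _).congr fun w => ?_))
    simp [Fin.sum_univ_three, ← sub_eq_add_neg, sub_eq_zero]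
  · refine isAutomaticRel_of_regularPred ((hmem 2).and ((regularPred_linear hb ![1, -1]
      (F := fun i w => w.filterMap fun a => a i) fun i => letterwise_filterMap _).congr fun w => ?_))
    simp [← sub_eq_add_neg, sub_eq_zero]
  · refine isAutomaticRel_of_regularPred ((hmem 2).and ?_)
    -- `x < y` holds when `x + z = y` for some word `z` without sign and of nonzero value. Here `z`
    -- ranges over all words, not only over `A`.
    have h := ((regularPred_apply (X := SignedDigit b) (fun o => o = some (Sum.inr ())) (-1)).not.and
      (regularPred_linear hb ![1] (F := fun _ : Fin 1 => fun w => w)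
        fun _ => letterwise_id).not).filterMap
      (Prod.snd : Option (Fin 2 → Option (SignedDigit b)) × Option (SignedDigit b) → _)
    have h' := regularPred_linear hb ![1, -1, 1] (F := ![
      fun w : ZWord (Option (Fin 2 → Option (SignedDigit b)) × Option (SignedDigit b)) =>
        (w.filterMap Prod.fst).filterMap fun a => a 0,
      fun w => (w.filterMap Prod.fst).filterMap fun a => a 1, fun w => w.filterMap Prod.snd])
      (fun i => by fin_cases i <;> simp <;> fun_prop)
    refine (RegularPred.exists (P := fun w z => (¬ z (-1) = some (Sum.inr ()) ∧
      interleavedValue b z ≠ 0) ∧ interleavedValue b (w.filterMap fun a => a 0) +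
      interleavedValue b z = interleavedValue b (w.filterMap fun a => a 1))
      ((h.and h').congr fun w => ?_)).congr fun w => ?_
    · simp only [Fin.sum_univ_three, Finset.univ_unique, Finset.sum_singleton]
      simp
      intros
      constructor <;> intro <;> linarith
    · constructor
      · intro hlt
        have hd : interleavedValue b (w.filterMap fun a => a 1) -
            interleavedValue b (w.filterMap fun a => a 0) ∈ adicRationals b :=
          (adicSubring hb).sub_mem (interleavedValue_mem hb _) (interleavedValue_mem hb _)
        rw [← image_interleavedWords hb] at hd
        obtain ⟨z, -, hz⟩ := hd
        have hpos : 0 < interleavedValue b z := by rw [hz]; exact sub_pos.2 hlt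
        refine ⟨z, ⟨fun hneg => ?_, hpos.ne'⟩, by rw [hz]; ring⟩
        rw [interleavedValue_eq, if_pos hneg] at hpos
        have := interleavedAbs_nonneg z
        linarith
      · rintro ⟨z, ⟨hneg, hne⟩, hz⟩
        have hnn : 0 ≤ interleavedValue b z := by
          rw [interleavedValue_eq, if_neg hneg, one_mul]
          exact interleavedAbs_nonneg z
        have := lt_of_le_of_ne hnn hne.symm
        change interleavedValue b _ < interleavedValue b _
        linarith
  · obtain ⟨n, m, hnm⟩ := (mem_adicRationals_iff hb).1 (interleavedValue_mem hb c)
    -- With the multiplier equal to `n / b ^ m`, clearing the denominator gives an integer linear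
    -- equation.
    refine isAutomaticRel_of_regularPred ((hmem 2).and ((regularPred_linear hb ![n, -(b : ℤ) ^ m]
      (F := fun i w => w.filterMap fun a => a i) fun i => letterwise_filterMap _).congr fun w => ?_))
    have hb0 : (b : ℝ) ^ m ≠ 0 := by positivity
    rw [hnm, Fin.sum_univ_two, div_mul_eq_mul_div, div_eq_iff hb0]
    simp only [Matrix.cons_val_zero, Matrix.cons_val_one, Int.cast_neg, Int.cast_pow,
      Int.cast_natCast]
    constructor <;> intro <;> linarith

/-! ### Opposite exponents and factorizations -/

theorem regularPred_single [Finite X] :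
    RegularPred fun t : ZWord X => ∃ i : ℤ, ∀ k, t k ≠ none ↔ k = i := by
  have hne : ∀ Y : Type, Finite Y → RegularPred fun t : ZWord Y => ∃ k, t k ≠ none := fun Y _ =>
    (regularPred_forall_letter (X := Y) (fun _ o => o = none) (fun _ => rfl)).not.congr
      fun t => by simp
  -- A domain is a singleton when it is nonempty and has no nonempty proper subset; the subset is
  -- guessed as a word over `Unit`.
  have hsub := (regularPred_forall_letter (X := Option X × Option Unit)
    (fun _ o => o.bind Prod.snd ≠ none → o.bind Prod.fst ≠ none) (by simp)).and
    (((hne Unit inferInstance).filterMap Prod.snd).and (regularPred_forall_letter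
      (X := Option X × Option Unit)
      (fun _ o => o.bind Prod.fst ≠ none → o.bind Prod.snd ≠ none) (by simp)).not)
  refine ((hne X inferInstance).and (RegularPred.exists (P := fun (t : ZWord X) (t' : ZWord Unit) =>
    (∀ k, t' k ≠ none → t k ≠ none) ∧ (∃ k, t' k ≠ none) ∧ ¬ ∀ k, t k ≠ none → t' k ≠ none)
    hsub).not).congr fun t => ?_
  constructor
  · rintro ⟨i, hi⟩
    refine ⟨⟨i, (hi i).2 rfl⟩, ?_⟩
    rintro ⟨t', h₁, ⟨k, hk⟩, h₂⟩
    refine h₂ fun k' hk' => ?_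
    rwa [(hi k').1 hk', ← (hi k).1 (h₁ k hk)]
  · rintro ⟨⟨i, hi⟩, h⟩
    refine ⟨i, fun k => ⟨fun hk => ?_, fun hk => hk ▸ hi⟩⟩
    by_contra hki
    refine h ⟨⟨fun k => if k = i then some () else none, (finite_singleton i).subset fun k hk => ?_⟩,
      fun k hk => ?_, ⟨i, by simp⟩, fun hall => hall k hk (if_neg hki)⟩
    · by_contra hne
      exact hk (if_neg hne)
    · by_contra hne
      refine hk (if_neg ?_)
      rintro rfl
      exact hi hne

/-- The words `t` and `t'` have one symbol each, at positions that belong to opposite exponents. -/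
def IsMirrorPair (t t' : ZWord Unit) : Prop :=
  ∃ j : ℤ, (∀ k : ℤ, t k ≠ none ↔ k = interleavedPosition j) ∧
    ∀ k : ℤ, t' k ≠ none ↔ k = interleavedPosition (-j)

/-- For `j > 0` the exponents `j` and `-j` stand at `2 * j - 1` and `2 * j`, so mirroring exchanges
each odd position with its successor and fixes `0`. -/
theorem isMirrorPair_iff (t t' : ZWord Unit) : IsMirrorPair t t' ↔
    ((∃ i : ℤ, ∀ k, t k ≠ none ↔ k = i) ∧ ∃ i : ℤ, ∀ k, t' k ≠ none ↔ k = i) ∧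
    ∀ k : ℤ, ((posClass k).1 = false → t k = none) ∧
      ((posClass k).2.2 = true → (t k ≠ none ↔ t' k ≠ none)) ∧
      (((posClass k).1 = true ∧ (posClass k).2.1 = false) →
        ((t k ≠ none ↔ t' (k + 1) ≠ none) ∧ (t (k + 1) ≠ none ↔ t' k ≠ none))) := by
  simp only [posClass, decide_eq_true_eq, decide_eq_false_iff_not]
  constructor
  · rintro ⟨j, h, h'⟩
    refine ⟨⟨⟨_, h⟩, _, h'⟩, fun k => ?_⟩
    have hk : t k = none ↔ k ≠ interleavedPosition j := by
      rw [← not_iff_not, ← ne_eq, h]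
      simp
    rw [hk, h, h', h, h']
    simp only [interleavedPosition]
    split_ifs <;> omega
  · rintro ⟨⟨⟨i, hi⟩, i', hi'⟩, h⟩
    have h0 : 0 ≤ i := by
      by_contra hneg
      exact (hi i).2 rfl ((h i).1 hneg)
    refine ⟨interleavedExponent i.toNat, ?_⟩
    rw [interleavedPosition_interleavedExponent]
    have hi'' : i' = interleavedPosition (-interleavedExponent i.toNat) := by
      have h₁ := (h i).2
      have h₂ := (h (i - 1)).2
      rw [sub_add_cancel] at h₂
      simp only [hi, hi', true_iff] at h₁ h₂
      simp only [interleavedPosition, interleavedExponent]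
      split_ifs <;> omega
    refine ⟨fun k => ?_, fun k => ?_⟩
    · rw [hi, Int.toNat_of_nonneg h0]
    · rw [hi', hi'']

theorem regularPred_isMirrorPair {F G : ZWord X → ZWord Unit} (hF : Letterwise F)
    (hG : Letterwise G) : RegularPred fun w => IsMirrorPair (F w) (G w) := by
  have h := ((regularPred_single (X := Unit)).filterMap (Prod.fst : Option Unit × Option Unit → _)
    |>.and ((regularPred_single (X := Unit)).filterMap Prod.snd)).and
    (regularPred_local (X := Option Unit × Option Unit) (fun q q' =>
      (q.1.1 = false → q.2.bind Prod.fst = none) ∧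
      (q.1.2.2 = true → (q.2.bind Prod.fst ≠ none ↔ q.2.bind Prod.snd ≠ none)) ∧
      ((q.1.1 = true ∧ q.1.2.1 = false) →
        ((q.2.bind Prod.fst ≠ none ↔ q'.2.bind Prod.snd ≠ none) ∧
          (q'.2.bind Prod.fst ≠ none ↔ q.2.bind Prod.snd ≠ none)))) (by simp))
  refine ((h.congr (Q := fun u => IsMirrorPair (u.filterMap Prod.fst) (u.filterMap Prod.snd))
    fun u => isMirrorPair_iff _ _).comp (hF.conv hG)).congr fun w => ?_
  simp

theorem exists_isMirrorPair (j : ℤ) : ∃ t t', IsMirrorPair t t' ∧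
    (∀ k : ℤ, t k ≠ none ↔ k = interleavedPosition j) ∧
    ∀ k : ℤ, t' k ≠ none ↔ k = interleavedPosition (-j) := by
  have h : ∀ i : ℤ, ∃ t : ZWord Unit, ∀ k : ℤ, t k ≠ none ↔ k = i := fun i =>
    ⟨⟨fun k => if k = i then some () else none, (finite_singleton i).subset fun k hk => by
      by_contra hne
      exact hk (if_neg hne)⟩, fun k => by simp⟩
  obtain ⟨t, ht⟩ := h (interleavedPosition j)
  obtain ⟨t', ht'⟩ := h (interleavedPosition (-j))
  exact ⟨t, t', ⟨j, ht, ht'⟩, ht, ht'⟩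

/-- The numeral with the digit `1` at the positions of the domain of `t`. -/
def onesNumeral (hb : 2 ≤ b) (t : ZWord Unit) : ZWord (SignedDigit b) :=
  t.filterMap fun _ => some (Sum.inl ⟨1, hb⟩)

@[fun_prop]
theorem letterwise_onesNumeral (hb : 2 ≤ b) : Letterwise fun t => onesNumeral hb t :=
  letterwise_filterMap _

/-- The word has gaps and need not be a legal numeral; blanks count as the digit `0` in its value.
-/
theorem interleavedValue_onesNumeral (hb : 2 ≤ b) {t : ZWord Unit} {j : ℤ}
    (ht : ∀ k : ℤ, t k ≠ none ↔ k = interleavedPosition j) :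
    interleavedValue b (onesNumeral hb t) = (b : ℝ) ^ j := by
  have hsign : onesNumeral hb t (-1) ≠ some (Sum.inr ()) := by
    simp [onesNumeral, Option.bind_eq_some_iff]
  rw [interleavedValue_eq, if_neg hsign, one_mul, interleavedAbs, finsum_interleavedExponent,
    finsum_eq_single _ j]
  · obtain ⟨_, h⟩ := Option.ne_none_iff_exists'.1 ((ht _).2 rfl)
    simp [onesNumeral, h, digitValue]
  · intro i hi
    have : t (interleavedPosition i) = none := by
      by_contra hne
      exact hi (interleavedPosition_injective ((ht _).1 hne))
    simp [onesNumeral, this, digitValue]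

/-- If `b` is a prime power, then up to powers of `b` there are finitely many factorizations of
a positive number with a finite expansion in base `b`. -/
theorem exists_factorization (hp : IsPrimePow b) {r : ℝ} {n₀ m₀ : ℕ} (hn₀ : 0 < n₀)
    (hr : r = n₀ / (b : ℝ) ^ m₀) {u v : ℝ} (hu : u ∈ adicRationals b) (hv : v ∈ adicRationals b)
    (hu0 : 0 < u) (hv0 : 0 < v) (huv : u * v = r) :
    ∃ c ∈ (n₀ * b).divisors, r / c ∈ adicRationals b ∧
      ∃ j : ℤ, u = c * (b : ℝ) ^ j ∧ v = r / c * (b : ℝ) ^ (-j) := by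
  have hb : 2 ≤ b := hp.two_le
  have hb0 : (b : ℝ) ≠ 0 := by
    have : b ≠ 0 := by omega
    exact_mod_cast this
  have hbpos : ∀ m : ℕ, (0 : ℝ) < (b : ℝ) ^ m := fun m => by positivity
  have hnat : ∀ {x : ℝ}, x ∈ adicRationals b → 0 < x → ∃ n m : ℕ, 0 < n ∧ x = n / (b : ℝ) ^ m := by
    intro x hx hx0
    obtain ⟨n, m, rfl⟩ := (mem_adicRationals_iff hb).1 hx
    have hn : 0 < n := by
      have := (div_pos_iff_of_pos_right (hbpos m)).1 hx0
      exact_mod_cast this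
    refine ⟨n.toNat, m, by omega, ?_⟩
    congr 1
    have : ((n.toNat : ℤ) : ℝ) = n := by rw [Int.toNat_of_nonneg hn.le]
    exact_mod_cast this.symm
  obtain ⟨n₁, m₁, hn₁, hu₁⟩ := hnat hu hu0
  obtain ⟨n₂, m₂, hn₂, hv₂⟩ := hnat hv hv0
  -- All full factors `b` of the numerator of `u` go into the power of `b`; what remains is `c`.
  obtain ⟨e, c, hc, hn₁c⟩ := Nat.exists_eq_pow_mul_and_not_dvd hn₁.ne' b (by omega)
  have hc0 : c ≠ 0 := by
    rintro rfl
    exact hc (dvd_zero _)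
  have hcr : (c : ℝ) ≠ 0 := by exact_mod_cast hc0
  have huc : u = c * (b : ℝ) ^ ((e : ℤ) - m₁) := by
    rw [hu₁, hn₁c, zpow_sub₀ hb0, zpow_natCast, zpow_natCast]
    push_cast
    ring
  have hvr : v = r / c * (b : ℝ) ^ (-((e : ℤ) - m₁)) := by
    rw [← huv, huc, zpow_neg]
    field_simp
  have hdvd : c ∣ n₀ * b ^ (m₁ + m₂) := by
    refine ⟨b ^ e * n₂ * b ^ m₀, ?_⟩
    have h : (n₀ : ℝ) * (b : ℝ) ^ (m₁ + m₂) = n₁ * n₂ * (b : ℝ) ^ m₀ := by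
      have := huv
      rw [hu₁, hv₂, hr, div_mul_div_comm, ← pow_add, div_eq_div_iff (hbpos _).ne' (hbpos _).ne']
        at this
      exact this.symm
    have h' : n₀ * b ^ (m₁ + m₂) = n₁ * n₂ * b ^ m₀ := by exact_mod_cast h
    rw [h', hn₁c]
    ring
  refine ⟨c, ?_, ?_, _, huc, hvr⟩
  · rw [Nat.mem_divisors]
    refine ⟨?_, by positivity⟩
    -- Here the prime power is used. With `b = q ^ k` and `c = q ^ a * c₀`, the factor `c₀` is prime
    -- to `b` and so divides `n₀`, while `¬ b ∣ c` bounds `a` and gives `q ^ a ∣ b`. For several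
    -- primes in `b`, a high power of one of them could survive in `c`.
    obtain ⟨q, k, hq, hk, rfl⟩ := hp
    have hq' := hq.nat_prime
    obtain ⟨a, c₀, hc₀, hca⟩ := Nat.exists_eq_pow_mul_and_not_dvd hc0 q hq'.ne_one
    have hcop : Nat.Coprime c₀ ((q ^ k) ^ (m₁ + m₂)) :=
      (((Nat.Prime.coprime_iff_not_dvd hq').2 hc₀).symm.pow_right _).pow_right _
    have h₁ : c₀ ∣ n₀ := hcop.dvd_of_dvd_mul_right ((Dvd.intro_left _ hca.symm).trans hdvd)
    have h₂ : q ^ a ∣ q ^ k := by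
      refine pow_dvd_pow q ?_
      by_contra hlt
      exact hc (hca ▸ (pow_dvd_pow q (by omega)).mul_right c₀)
    rw [hca, mul_comm]
    exact mul_dvd_mul h₁ h₂
  · have : r / c = v * (b : ℝ) ^ ((e : ℤ) - m₁) := by
      rw [hvr, mul_assoc, ← zpow_add₀ hb0]
      simp
    rw [this]
    exact (adicSubring hb).mul_mem hv (zpow_mem_adicSubring hb _)

/-! ### Equality of areas is semiautomatic -/

section Area

variable {A : Set (ZWord (SignedDigit b))} {D : Set (ZWord Γ)} {E : ZWord Γ → Set (ℝ × ℝ)}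

theorem regularPred_sub_eq_mul [Finite X] (hb : 2 ≤ b) {q : ℝ} (hq : q ∈ adicRationals b)
    {F G H : ZWord X → ZWord (SignedDigit b)} (hF : Letterwise F) (hG : Letterwise G)
    (hH : Letterwise H) :
    RegularPred fun w => interleavedValue b (F w) - interleavedValue b (G w) =
      q * interleavedValue b (H w) := by
  obtain ⟨n, m, rfl⟩ := (mem_adicRationals_iff hb).1 hq
  have hb0 : (b : ℝ) ^ m ≠ 0 := by positivity
  refine (regularPred_linear hb ![(b : ℤ) ^ m, -(b : ℤ) ^ m, -n] (F := ![F, G, H])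
    fun i => by fin_cases i <;> assumption).congr fun w => ?_
  rw [div_mul_eq_mul_div, eq_div_iff hb0]
  simp only [Fin.sum_univ_three, Matrix.cons_val_zero, Matrix.cons_val_one, Matrix.cons_val,
     Int.cast_neg, Int.cast_pow, Int.cast_natCast]
  constructor <;> intro <;> linarith

/-- The rectangles whose sides are `c * b ^ j` and `q * b ^ (-j)` for some `j`. -/
theorem regularPred_sides [Finite Γ] (hb : 2 ≤ b) (hA : IsGrid A (interleavedValue b))
    (hE : IsAutomaticRectangleFamily A (interleavedValue b) D E) (c : ℕ) {q : ℝ}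
    (hq : q ∈ adicRationals b) :
    RegularPred fun d => ∃ x₁ x₂ y₁ y₂ t t',
      IsRectangle A (interleavedValue b) D E x₁ x₂ y₁ y₂ d ∧ IsMirrorPair t t' ∧
      interleavedValue b x₂ - interleavedValue b x₁ = c * interleavedValue b (onesNumeral hb t) ∧
      interleavedValue b y₂ - interleavedValue b y₁ = q * interleavedValue b (onesNumeral hb t') := by
  refine RegularPred.exists (RegularPred.exists (RegularPred.exists (RegularPred.exists
    (RegularPred.exists (RegularPred.exists ?_)))))
  refine RegularPred.and ?_ (RegularPred.and ?_ (RegularPred.and ?_ ?_))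
  · exact hA.regularPred_isRectangle hE (by fun_prop) (by fun_prop) (by fun_prop) (by fun_prop)
      (by fun_prop)
  · exact regularPred_isMirrorPair (by fun_prop) (by fun_prop)
  · exact regularPred_sub_eq_mul hb (natCast_mem (adicSubring hb) c) (by fun_prop) (by fun_prop)
      (by fun_prop)
  · exact regularPred_sub_eq_mul hb hq (by fun_prop) (by fun_prop) (by fun_prop)

/-- The rectangles of area `r` split into finitely many classes, one for each admissible `c`, with
sides `c * b ^ j` and `r / c * b ^ (-j)`. -/
theorem regularPred_volume_eq [Finite Γ] (hp : IsPrimePow b) (hA : IsGrid A (interleavedValue b))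
    (hE : IsAutomaticRectangleFamily A (interleavedValue b) D E) {d₀ : ZWord Γ} (hd₀ : d₀ ∈ D) :
    RegularPred fun d => d ∈ D ∧ volume (E d) = volume (E d₀) := by
  have hb := hp.two_le
  have hb0 : (b : ℝ) ≠ 0 := by
    have : b ≠ 0 := by omega
    exact_mod_cast this
  have hside : ∀ x y, interleavedValue b x - interleavedValue b y ∈ adicRationals b := fun x y =>
    (adicSubring hb).sub_mem (interleavedValue_mem hb x) (interleavedValue_mem hb y)
  obtain ⟨x₁, x₂, y₁, y₂, h₀⟩ := hE.exists_corners hd₀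
  set r := (interleavedValue b x₂ - interleavedValue b x₁) *
    (interleavedValue b y₂ - interleavedValue b y₁) with hr
  have hr0 : 0 < r := mul_pos (sub_pos.2 h₀.lt_x) (sub_pos.2 h₀.lt_y)
  have hrmem : r ∈ adicRationals b := (adicSubring hb).mul_mem (hside _ _) (hside _ _)
  obtain ⟨n, m₀, hnm⟩ := (mem_adicRationals_iff hb).1 hrmem
  have hn : 0 < n := by
    rw [hnm] at hr0
    have := (div_pos_iff_of_pos_right (by positivity)).1 hr0
    exact_mod_cast this
  lift n to ℕ using hn.le
  rw [Int.cast_natCast] at hnm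
  have hn₀ : 0 < n := by exact_mod_cast hn
  have hreg : ∀ c : ℕ, RegularPred fun d => r / c ∈ adicRationals b ∧ ∃ x₁ x₂ y₁ y₂ t t',
      IsRectangle A (interleavedValue b) D E x₁ x₂ y₁ y₂ d ∧ IsMirrorPair t t' ∧
      interleavedValue b x₂ - interleavedValue b x₁ = c * interleavedValue b (onesNumeral hb t) ∧
      interleavedValue b y₂ - interleavedValue b y₁ =
        r / c * interleavedValue b (onesNumeral hb t') := fun c => by
    -- Multiplication by `r / c` is regular only as an element of the ring; other divisors `c`
    -- contribute nothing.
    by_cases hq : r / c ∈ adicRationals b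
    · exact RegularPred.const.and (regularPred_sides hb hA hE c hq)
    · exact (RegularPred.const (P := False)).congr fun d => by simp [hq]
  refine (RegularPred.exists_finset (n * b).divisors fun c _ => hreg c).congr fun d => ?_
  constructor
  · rintro ⟨hd, hvol⟩
    obtain ⟨x₁', x₂', y₁', y₂', h⟩ := hE.exists_corners hd
    have hx := sub_pos.2 h.lt_x
    have hy := sub_pos.2 h.lt_y
    rw [h.volume_eq, h₀.volume_eq, ENNReal.ofReal_eq_ofReal_iff (mul_pos hx hy).le hr0.le] at hvol
    obtain ⟨c, hc, hq, j, hu, hv⟩ :=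
      exists_factorization hp hn₀ hnm (hside _ _) (hside _ _) hx hy hvol
    obtain ⟨t, t', htt', ht, ht'⟩ := exists_isMirrorPair j
    refine ⟨c, hc, hq, x₁', x₂', y₁', y₂', t, t', h, htt', ?_, ?_⟩
    · rw [interleavedValue_onesNumeral hb ht, hu]
    · rw [interleavedValue_onesNumeral hb ht', hv]
  · rintro ⟨c, hc, -, x₁', x₂', y₁', y₂', t, t', h, ⟨j, ht, ht'⟩, hu, hv⟩
    refine ⟨h.index_mem, ?_⟩
    have hc0 : (c : ℝ) ≠ 0 := by
      exact_mod_cast (Nat.pos_of_mem_divisors hc).ne'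
    rw [h.volume_eq, h₀.volume_eq, hu, hv, interleavedValue_onesNumeral hb ht,
      interleavedValue_onesNumeral hb ht', zpow_neg, ← hr]
    congr 1
    field_simp

theorem isSemiautomaticRel_sameArea [Finite Γ] (hp : IsPrimePow b)
    (hA : IsGrid A (interleavedValue b))
    (hE : IsAutomaticRectangleFamily A (interleavedValue b) D E) :
    IsSemiautomaticRel (sameArea D E) := by
  have key : ∀ x : ZWord Γ, RegularPred fun w => (w ∈ D ∧ x ∈ D) ∧ volume (E w) = volume (E x) := by
    intro x
    by_cases hx : x ∈ D
    · exact (regularPred_volume_eq hp hA hE hx).congr fun w => by simp [hx]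
    · exact (RegularPred.const (P := False)).congr fun w => by simp [hx]
  intro i x
  fin_cases i
  · refine (key (x 1)).congr fun w => ?_
    simp [sameArea, Fin.forall_fin_two]
  · refine (key (x 0)).congr fun w => ?_
    simp [sameArea, Fin.forall_fin_two, and_comm, eq_comm]

end Area

end

theorem mainTheorem11 :
    -- in every grid
    (∀ (α : Type) [Finite α] (A : Set (ZWord α)) (val : ZWord α → ℝ), IsGrid A val →
      -- the axis-parallel rectangles form an automatic family,
      (∃ (Γ : Type) (_ : Finite Γ) (D : Set (ZWord Γ)) (E : ZWord Γ → Set (ℝ × ℝ)),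
        IsAutomaticRectangleFamily A val D E) ∧
      -- and equality of areas is not automatic on any such family
      (∀ (Γ : Type) [Finite Γ] (D : Set (ZWord Γ)) (E : ZWord Γ → Set (ℝ × ℝ)),
        IsAutomaticRectangleFamily A val D E → ¬ IsAutomaticRel (sameArea D E))) ∧
    -- for a prime power `p`, with interleaved numerals, `𝔻_p` is a grid with semiautomatic
    -- equality of areas
    (∀ p : ℕ, IsPrimePow p →
      (IsRegularSet (interleavedWords p) ∧
        interleavedValue p '' interleavedWords p = adicRationals p) ∧
      ∀ A ⊆ interleavedWords p, IsRegularSet A → interleavedValue p '' A = adicRationals p →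
        IsGrid A (interleavedValue p) ∧
        ∀ (Γ : Type) [Finite Γ] (D : Set (ZWord Γ)) (E : ZWord Γ → Set (ℝ × ℝ)),
          IsAutomaticRectangleFamily A (interleavedValue p) D E →
            IsSemiautomaticRel (sameArea D E)) := by
  refine ⟨fun α _ A val hA => ⟨hA.exists_isAutomaticRectangleFamily, fun Γ _ D E hE =>
    hA.not_isAutomaticRel_sameArea hE⟩, fun p hp => ?_⟩
  refine ⟨⟨isRegularSet_interleavedWords, image_interleavedWords hp.two_le⟩,
    fun A _ hA hval => ?_⟩
  have hgrid := isGrid_interleaved hp.two_le hA hval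
  exact ⟨hgrid, fun Γ _ D E hE => isSemiautomaticRel_sameArea hp hgrid hE⟩
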